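/- Let $\mathfrak H$ be a real separable Hilbert space and let $X=\{X(f):f\in\mathfrak H\}$ be a family of centered, square integrable real random variables on a probability space $(\Omega,\mathcal F,\mathbb P)$ such that $\mathbb E[X(f)X(g)]=(f,g)_{\mathfrak H}$ for all $f,g\in\mathfrak H$. A resolution of the identity is a family $\pi=\{\pi_t:t\in[0,1]\}$ of orthogonal projections of $\mathfrak H$ such that $\pi_0=0$, $\pi_1=\mathrm{id}$, $\pi_s\mathfrak H\subseteq\pi_t\mathfrak H$ for $s<t$, and $t\mapsto\pi_t h$ is norm-continuous for every $h\in\mathfrak H$. The class $\mathcal R_X(\mathfrak H)$ consists of those $\pi$ such that, for all $m\ge 2$, $h_1,\dots,h_m\in\mathfrak H$ and $0\le t_0<t_1<\dots<t_m\le1$, the random variables $X((\pi_{t_i}-\pi_{t_{i-1}})h_i)$, $i=1,\dots,m$, are independent. For $\pi\in\mathcal R_X(\mathfrak H)$ put $\mathcal F^\pi_t(X)=\sigma\{X(\pi_tf):f\in\mathfrak H\}$, and let $L^2_\pi(\mathfrak H,X)$ be the space of (classes of) $\sigma(X)$-measurable $\mathfrak H$-valued random elements $u$ with $\mathbb E\|u\|_{\mathfrak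 H}^2<\infty$ such that $(u,\pi_th)_{\mathfrak H}$ is $\mathcal F^\pi_t(X)$-measurable (up to null sets) for all $t\in[0,1]$, $h\in\mathfrak H$. The integral $J^\pi_X$ is the unique $L^2$-continuous linear map from $L^2_\pi(\mathfrak H,X)$ to $L^2(\mathbb P)$ such that $J^\pi_X(\Phi(\pi_t-\pi_s)f)=\Phi\,X((\pi_t-\pi_s)f)$ whenever $s<t$, $f\in\mathfrak H$ and $\Phi$ is square integrable and $\mathcal F^\pi_s(X)$-measurable. If $\mathcal R_X(\mathfrak H)\neq\emptyset$, then for each $h\in\mathfrak H$ there is a unique pair $(c^2(h),\nu_h)$, with $c^2(h)\in[0,\infty)$ and $\nu_h$ a measure on $\mathbb R$ with $\nu_h(\{0\})=0$, $\int (x^2\wedge1)\,\nu_h(dx)<\infty$ and $\int_{|x|\ge1}x^2\,\nu_h(dx)<\infty$, such that $\mathbb E[e^{i\lambda X(h)}]=\exp[\psi_{\mathfrak H}(h;\lambda)]$ for all $\lambda\in\mathbb R$, where $$\psi_{\mathfrak H}(h;\lambda)=-\frac{c^2(h)\lambda^2}{2}+\int_{\mathbb R}\bigl(e^{i\lambda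 x}-1-i\lambda x\bigr)\,\nu_h(dx).$$ Let $\pi^{(n)}\in\mathcal R_X(\mathfrak H)$ and $u_n\in L^2_{\pi^{(n)}}(\mathfrak H,X)$, $n\ge1$, be arbitrary sequences (the $\pi^{(n)}$ need not be nested). Let $\mu$ be a deterministic probability measure on $\mathbb R$ whose characteristic function $\phi(\lambda)=\int e^{i\lambda x}\mu(dx)$ satisfies $\phi(\lambda)\ne0$ for every $\lambda\in\mathbb R$. If, for every $\lambda\in\mathbb R$, $$\exp[\psi_{\mathfrak H}(u_n;\lambda)]\longrightarrow\phi(\lambda)\quad\text{in probability as }n\to\infty,$$ then, for every $\lambda\in\mathbb R$, $\mathbb E\bigl[\exp(i\lambda J_X^{\pi^{(n)}}(u_n))\bigr]\to\phi(\lambda)$ as $n\to\infty$; that is, the law of $J_X^{\pi^{(n)}}(u_n)$ converges weakly to $\mu$. -/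

import Mathlib

open MeasureTheory ProbabilityTheory Filter Topology
open scoped RealInnerProductSpace ENNReal

noncomputable section

/-- A (continuous) resolution of the identity of the real Hilbert space `H`. -/
structure ResolutionOfIdentity (H : Type*) [NormedAddCommGroup H] [InnerProductSpace ℝ H]
    [CompleteSpace H] where
  /-- The family of projections `π_t`, `t ∈ [0,1]`. -/
  proj : unitInterval → (H →L[ℝ] H)
  /-- A star projection (self-adjoint idempotent) is the same as an orthogonal projection. -/
  isStarProjection_proj : ∀ t, IsStarProjection (proj t)
  proj_zero : proj 0 = 0
  proj_one : proj 1 = ContinuousLinearMap.id ℝ H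
  range_mono : ∀ s t : unitInterval, s < t → Set.range (proj s) ⊆ Set.range (proj t)
  tendsto_proj : ∀ (t₀ : unitInterval) (h : H),
    Tendsto (fun t => ‖proj t h - proj t₀ h‖) (𝓝 t₀) (𝓝 0)

section Family

variable {Ω : Type*} [MeasurableSpace Ω] {H : Type*} [NormedAddCommGroup H]
  [InnerProductSpace ℝ H]

/-- `X = {X(f) : f ∈ H}` is a family of centered, square integrable random variables such that
`E[X(f) X(g)] = ⟪f, g⟫` for all `f, g ∈ H`. -/
structure IsIsometricProcess (P : Measure Ω) (X : H → Ω → ℝ) : Prop where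
  measurable : ∀ f, Measurable (X f)
  memLp : ∀ f, MemLp (X f) 2 P
  centered : ∀ f, ∫ ω, X f ω ∂P = 0
  covariance : ∀ f g, ∫ ω, X f ω * X g ω ∂P = ⟪f, g⟫

/-- The σ-field `σ(X)` generated by the family `X`. -/
abbrev sigmaProcess (X : H → Ω → ℝ) : MeasurableSpace Ω :=
  ⨆ f : H, MeasurableSpace.comap (X f) inferInstance

/-- `(c², ν)` is the Lévy-Khintchine pair of the centered, square integrable, infinitely divisible
random variable `Y`. -/
structure IsLevyKhintchinePair (P : Measure Ω) (Y : Ω → ℝ) (c2 : ℝ) (ν : Measure ℝ) : Prop where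
  nonneg : 0 ≤ c2
  no_atom_zero : ν {0} = 0
  lintegral_min_lt_top : ∫⁻ x, ENNReal.ofReal (min (x ^ 2) 1) ∂ν < ∞
  lintegral_sq_lt_top : ∫⁻ x in {x : ℝ | 1 ≤ |x|}, ENNReal.ofReal (x ^ 2) ∂ν < ∞
  charFun_eq : ∀ l : ℝ,
    ∫ ω, Complex.exp (Complex.I * (l : ℂ) * (Y ω : ℂ)) ∂P =
      Complex.exp (-((c2 : ℂ) * (l : ℂ) ^ 2 / 2) +
        ∫ x, (Complex.exp (Complex.I * (l : ℂ) * (x : ℂ)) - 1 - Complex.I * (l : ℂ) * (x : ℂ)) ∂ν)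

open Classical in
/-- The Lévy-Khintchine pair `(c²(h), ν_h)` of `X(h)`
(with the default value `(0, 0)` if `X(h)` has none). -/
def levyKhintchinePair (P : Measure Ω) (X : H → Ω → ℝ) (h : H) : ℝ × Measure ℝ :=
  if hp : ∃ p : ℝ × Measure ℝ, IsLevyKhintchinePair P (X h) p.1 p.2 then hp.choose else (0, 0)

/-- The Lévy-Khintchine exponent `ψ_H(h; l)`. -/
def levyExponent (P : Measure Ω) (X : H → Ω → ℝ) (h : H) (l : ℝ) : ℂ :=
  -(((levyKhintchinePair P X h).1 : ℂ) * (l : ℂ) ^ 2 / 2) +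
    ∫ x, (Complex.exp (Complex.I * (l : ℂ) * (x : ℂ)) - 1 - Complex.I * (l : ℂ) * (x : ℂ))
      ∂(levyKhintchinePair P X h).2

end Family

section Integral

variable {Ω : Type*} [MeasurableSpace Ω] {H : Type*} [NormedAddCommGroup H]
  [InnerProductSpace ℝ H] [CompleteSpace H]

/-- The class `R_X(H)` of the resolutions of the identity with respect to which `X` has independent
increments. -/
def independentResolutions (P : Measure Ω) (X : H → Ω → ℝ) : Set (ResolutionOfIdentity H) :=
  {π | ∀ (m : ℕ), 2 ≤ m → ∀ (h : Fin m → H) (t : Fin (m + 1) → unitInterval), StrictMono t →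
    iIndepFun (fun i : Fin m => X ((π.proj (t i.succ) - π.proj (t i.castSucc)) (h i))) P}

/-- The σ-field `F_t^π(X) = σ{X(π_t f) : f ∈ H}`. -/
abbrev resolutionFiltration (X : H → Ω → ℝ) (π : ResolutionOfIdentity H) (t : unitInterval) :
    MeasurableSpace Ω :=
  ⨆ f : H, MeasurableSpace.comap (X (π.proj t f)) inferInstance

/-- `u` is (a version of) an element of `L²_π(H, X)`: it is `σ(X)`-measurable, square integrable
and `π`-adapted. As usual for elements of an `L²` space, measurability is up to null sets. -/
structure IsAdaptedL2 (P : Measure Ω) (X : H → Ω → ℝ) (π : ResolutionOfIdentity H)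
    (u : Ω → H) : Prop where
  measurable : AEStronglyMeasurable[sigmaProcess X] u P
  memLp : MemLp u 2 P
  adapted : ∀ (t : unitInterval) (h : H),
    AEStronglyMeasurable[resolutionFiltration X π t] (fun ω => ⟪u ω, π.proj t h⟫) P

/-- A (representation of an) elementary `π`-adapted random element
`∑ i, Φ_i (π_{t_i} - π_{s_i}) f_i`, with `s_i < t_i`, `f_i ∈ H` and `Φ_i` square integrable and
`F_{s_i}^π(X)`-measurable. Scalar coefficients are absorbed into the `Φ_i`. -/
structure ElementaryIntegrand (P : Measure Ω) (X : H → Ω → ℝ) (π : ResolutionOfIdentity H) where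
  n : ℕ
  s : Fin n → unitInterval
  t : Fin n → unitInterval
  lt : ∀ i, s i < t i
  f : Fin n → H
  Φ : Fin n → Ω → ℝ
  measurable : ∀ i, Measurable[resolutionFiltration X π (s i)] (Φ i)
  memLp : ∀ i, MemLp (Φ i) 2 P

/-- The `H`-valued random variable `∑ i, Φ_i (π_{t_i} - π_{s_i}) f_i`. -/
def ElementaryIntegrand.toFun {P : Measure Ω} {X : H → Ω → ℝ} {π : ResolutionOfIdentity H}
    (e : ElementaryIntegrand P X π) (ω : Ω) : H :=
  ∑ i, e.Φ i ω • (π.proj (e.t i) - π.proj (e.s i)) (e.f i)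

/-- The integral `∑ i, Φ_i X((π_{t_i} - π_{s_i}) f_i)` of an elementary integrand. -/
def ElementaryIntegrand.integral {P : Measure Ω} {X : H → Ω → ℝ} {π : ResolutionOfIdentity H}
    (e : ElementaryIntegrand P X π) (ω : Ω) : ℝ :=
  ∑ i, e.Φ i ω * X ((π.proj (e.t i) - π.proj (e.s i)) (e.f i)) ω

/-- `J` is (a version of) the value at `u` of the `L²`-continuous extension of the integral of
elementary integrands. -/
def IsItoIntegral (P : Measure Ω) (X : H → Ω → ℝ) (π : ResolutionOfIdentity H)
    (u : Ω → H) (J : Ω → ℝ) : Prop :=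
  MemLp J 2 P ∧ ∃ e : ℕ → ElementaryIntegrand P X π,
    Tendsto (fun k => eLpNorm (fun ω => (e k).toFun ω - u ω) 2 P) atTop (𝓝 0) ∧
    Tendsto (fun k => eLpNorm (fun ω => (e k).integral ω - J ω) 2 P) atTop (𝓝 0)

open Classical in
/-- The Itô type integral `J_X^π(u)` (with the default value `0` if `u` cannot be integrated). -/
def itoIntegral (P : Measure Ω) (X : H → Ω → ℝ) (π : ResolutionOfIdentity H) (u : Ω → H) :
    Ω → ℝ :=
  if hJ : ∃ J : Ω → ℝ, IsItoIntegral P X π u J then hJ.choose else 0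

theorem aemeasurable_itoIntegral (P : Measure Ω) (X : H → Ω → ℝ) (π : ResolutionOfIdentity H)
    (u : Ω → H) : AEMeasurable (itoIntegral P X π u) P := by
  unfold itoIntegral
  split_ifs with hJ
  · exact hJ.choose_spec.1.aestronglyMeasurable.aemeasurable
  · exact aemeasurable_const

/-- The law of `J_X^π(u)`. -/
def itoLaw (P : Measure Ω) [IsProbabilityMeasure P] (X : H → Ω → ℝ) (π : ResolutionOfIdentity H)
    (u : Ω → H) : ProbabilityMeasure ℝ :=
  ⟨P.map (itoIntegral P X π u),
    Measure.isProbabilityMeasure_map (aemeasurable_itoIntegral P X π u)⟩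

end Integral

end

/-! Write `χ_l(h) = E exp(i l X(h))`. Because `exp ψ(h; l) = χ_l(h)`, the hypothesis says that
`χ_l(u_n) → φ(l)` in probability. Everything then rests on one inequality for a single resolution
and a single integrand (`IsItoIntegral.norm_charFun_sub_le`): for `0 < |φ| ≤ 1`, `|E exp(i l J(u)) -
φ| ≤ (6/|φ|) E|χ_l(u) - φ|`. Its constant does not depend on the resolution, so the resolutions need
not be related to each other. As `|χ_l| ≤ 1`, convergence in probability gives convergence in `L¹`,
and Lévy's continuity theorem concludes.

For an elementary integrand, refine all its intervals to one subdivision. Let `E_k` be the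
exponential of the `k`-th term of the integral and `c_k` its conditional characteristic function
given the past. By the freezing lemma, `c_k` is `χ_l` at the `k`-th piece of the integrand; by
independence of increments, the product of the `c_k` is `χ_l(u(ω))` for each fixed `ω`. The products
of the ratios `E_k / c_k` form a complex martingale of mean 1, which is made bounded by stopping it
before `|c_0 ⋯ c_k|` falls below `|φ|/2`. Comparing it with the product of the `E_k` gives the
inequality (`norm_integral_prod_sub_le`). Both sides are `L²`-continuous because `χ_l` is Lipschitz,
so the bound extends to limits of elementary integrands.

Two existence facts remain, since the integral and the exponent are defined with default values.
Elementary integrands are dense among adapted ones: an adapted element orthogonal to them yields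
martingales whose quadratic variation vanishes, because `t ↦ π_t f` is continuous. With the Itô
isometry this gives the integral. The Lévy-Khintchine pair comes from Kolmogorov's representation:
cutting `h` into small independent increments, the accompanying compound Poisson laws have exponents
`∫ K dG_n` with `G_n` of mass `‖h‖²`, and a vague cluster point of `G_n` represents `log χ_l(h)`. -/

noncomputable section

/-! ### Geometry of the projections `π_t` and of their increments -/

namespace ResolutionOfIdentity

variable {H : Type*} [NormedAddCommGroup H] [InnerProductSpace ℝ H] [CompleteSpace H]
  (π : ResolutionOfIdentity H)

theorem inner_proj_left (t : unitInterval) (x y : H) : ⟪π.proj t x, y⟫ = ⟪x, π.proj t y⟫ := by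
  have h := (π.isStarProjection_proj t).isSelfAdjoint
  rw [ContinuousLinearMap.isSelfAdjoint_iff_isSymmetric] at h
  exact h x y

theorem proj_proj_self (t : unitInterval) (x : H) : π.proj t (π.proj t x) = π.proj t x :=
  congrArg (fun A : H →L[ℝ] H => A x) (π.isStarProjection_proj t).isIdempotentElem

theorem proj_proj_of_ge {s t : unitInterval} (hst : s ≤ t) (x : H) :
    π.proj t (π.proj s x) = π.proj s x := by
  rcases hst.eq_or_lt with rfl | h
  · exact π.proj_proj_self s x
  · obtain ⟨y, hy⟩ := π.range_mono s t h ⟨x, rfl⟩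
    rw [← hy, proj_proj_self]

/-- The adjoint of `proj_proj_of_ge`: the inclusion of ranges only controls `π_t π_s`, and
self-adjointness reverses the order. -/
theorem proj_proj_of_le {s t : unitInterval} (hst : s ≤ t) (x : H) :
    π.proj s (π.proj t x) = π.proj s x := by
  refine ext_inner_right ℝ fun y => ?_
  rw [inner_proj_left, inner_proj_left, proj_proj_of_ge π hst, inner_proj_left]

/-- The projection `π_t - π_s` attached to the interval `(s, t]`. -/
def increment (s t : unitInterval) : H →L[ℝ] H := π.proj t - π.proj s

theorem increment_apply (s t : unitInterval) (x : H) :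
    π.increment s t x = π.proj t x - π.proj s x := rfl

theorem increment_self (s : unitInterval) : π.increment s s = 0 := sub_self _

theorem proj_increment_of_ge {s t r : unitInterval} (hst : s ≤ t) (htr : t ≤ r) (x : H) :
    π.proj r (π.increment s t x) = π.increment s t x := by
  rw [increment_apply, map_sub, proj_proj_of_ge π htr, proj_proj_of_ge π (hst.trans htr)]

theorem proj_increment_of_le {s t r : unitInterval} (hst : s ≤ t) (hrs : r ≤ s) (x : H) :
    π.proj r (π.increment s t x) = 0 := by
  rw [increment_apply, map_sub, proj_proj_of_le π hrs, proj_proj_of_le π (hrs.trans hst), sub_self]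

theorem inner_increment_left (s t : unitInterval) (x y : H) :
    ⟪π.increment s t x, y⟫ = ⟪x, π.increment s t y⟫ := by
  simp only [increment_apply, inner_sub_left, inner_sub_right, inner_proj_left]

theorem increment_increment {s t : unitInterval} (hst : s ≤ t) (x : H) :
    π.increment s t (π.increment s t x) = π.increment s t x := by
  rw [increment_apply, proj_increment_of_ge π hst le_rfl, proj_increment_of_le π hst le_rfl,
    sub_zero]

theorem inner_increment_increment {s t : unitInterval} (hst : s ≤ t) (x : H) :
    ⟪x, π.increment s t x⟫ = ‖π.increment s t x‖ ^ 2 := by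
  rw [← real_inner_self_eq_norm_sq, inner_increment_left, increment_increment π hst]

theorem inner_increment_increment_of_le {s t s' t' : unitInterval} (hst : s ≤ t) (hts' : t ≤ s')
    (hst' : s' ≤ t') (x y : H) : ⟪π.increment s t x, π.increment s' t' y⟫ = 0 := by
  rw [← proj_increment_of_ge π hst hts', inner_proj_left, proj_increment_of_le π hst' le_rfl,
    inner_zero_right]

theorem continuous_proj_apply (h : H) : Continuous fun t => π.proj t h :=
  continuous_iff_continuousAt.2 fun t₀ => tendsto_iff_norm_sub_tendsto_zero.2 (π.tendsto_proj t₀ h)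

end ResolutionOfIdentity

/-! ### Characteristic functions and `L²` distance -/

section CharFun

variable {Ω : Type*} [MeasurableSpace Ω] {P : Measure Ω}

theorem norm_exp_I_mul_ofReal_mul (l y : ℝ) :
    ‖Complex.exp (Complex.I * (l : ℂ) * (y : ℂ))‖ = 1 := by
  rw [mul_assoc, ← Complex.ofReal_mul, mul_comm, Complex.norm_exp_ofReal_mul_I]

theorem integrable_exp_I_mul [IsFiniteMeasure P] {Y : Ω → ℝ} (hY : AEStronglyMeasurable Y P)
    (l : ℝ) : Integrable (fun ω => Complex.exp (Complex.I * (l : ℂ) * (Y ω : ℂ))) P := by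
  refine Integrable.of_bound (C := 1) ?_ (ae_of_all _ fun ω => (norm_exp_I_mul_ofReal_mul l _).le)
  exact (by fun_prop : Continuous fun y : ℝ => Complex.exp (Complex.I * (l : ℂ) * (y : ℂ)))
    |>.comp_aestronglyMeasurable hY

theorem norm_exp_I_mul_sub_exp_I_mul_le (l y z : ℝ) :
    ‖Complex.exp (Complex.I * (l : ℂ) * (y : ℂ)) - Complex.exp (Complex.I * (l : ℂ) * (z : ℂ))‖
      ≤ |l| * |y - z| := by
  have h : Complex.exp (Complex.I * (l : ℂ) * (y : ℂ)) - Complex.exp (Complex.I * (l : ℂ) * (z : ℂ))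
      = Complex.exp (Complex.I * (l : ℂ) * (z : ℂ)) *
        (Complex.exp (Complex.I * ((l * (y - z) : ℝ) : ℂ)) - 1) := by
    rw [mul_sub, ← Complex.exp_add, mul_one]
    congr 2
    push_cast
    ring
  rw [h, norm_mul, norm_exp_I_mul_ofReal_mul, one_mul, ← abs_mul]
  exact Real.norm_exp_I_mul_ofReal_sub_one_le

theorem integral_abs_le_toReal_eLpNorm_two [IsProbabilityMeasure P] {Y : Ω → ℝ}
    (hY : MemLp Y 2 P) : ∫ ω, |Y ω| ∂P ≤ (eLpNorm Y 2 P).toReal := by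
  have h1 : eLpNorm Y 1 P ≤ eLpNorm Y 2 P :=
    eLpNorm_le_eLpNorm_of_exponent_le (by norm_num) hY.aestronglyMeasurable
  have h2 := integral_norm_eq_lintegral_enorm hY.aestronglyMeasurable
  rw [← eLpNorm_one_eq_lintegral_enorm] at h2
  simp only [Real.norm_eq_abs] at h2
  rw [h2]
  exact ENNReal.toReal_mono hY.2.ne h1

/-- The map `y ↦ exp(i l y)` is `|l|`-Lipschitz and the `L¹` norm is at most the `L²` norm. This
transfers bounds from elementary integrals to their `L²` limits. -/
theorem norm_integral_exp_I_mul_sub_le [IsProbabilityMeasure P] {Y Z : Ω → ℝ} (hY : MemLp Y 2 P)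
    (hZ : MemLp Z 2 P) (l : ℝ) :
    ‖∫ ω, Complex.exp (Complex.I * (l : ℂ) * (Y ω : ℂ)) ∂P -
        ∫ ω, Complex.exp (Complex.I * (l : ℂ) * (Z ω : ℂ)) ∂P‖
      ≤ |l| * (eLpNorm (fun ω => Y ω - Z ω) 2 P).toReal := by
  rw [← integral_sub (integrable_exp_I_mul hY.1 l) (integrable_exp_I_mul hZ.1 l)]
  calc _ ≤ ∫ ω, |l| * |Y ω - Z ω| ∂P := by
        refine norm_integral_le_of_norm_le ?_
          (ae_of_all _ fun ω => norm_exp_I_mul_sub_exp_I_mul_le l _ _)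
        exact (((hY.sub hZ).integrable (by norm_num)).abs).const_mul _
    _ ≤ _ := by
        rw [integral_const_mul]
        gcongr
        exact integral_abs_le_toReal_eLpNorm_two (hY.sub hZ)

end CharFun

/-- The characteristic function of `X(h)` at `l`. -/
def processCharFun {Ω H : Type*} [MeasurableSpace Ω] (P : Measure Ω) (X : H → Ω → ℝ) (l : ℝ)
    (h : H) : ℂ :=
  ∫ ω, Complex.exp (Complex.I * (l : ℂ) * (X h ω : ℂ)) ∂P

theorem norm_processCharFun_le {Ω H : Type*} [MeasurableSpace Ω] (P : Measure Ω)
    [IsProbabilityMeasure P] (X : H → Ω → ℝ) (l : ℝ) (h : H) : ‖processCharFun P X l h‖ ≤ 1 := by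
  refine (norm_integral_le_integral_norm _).trans ?_
  simp [norm_exp_I_mul_ofReal_mul]

/-! ### Almost sure linearity of `X`, deduced from its covariance -/

namespace IsIsometricProcess

variable {Ω : Type*} [MeasurableSpace Ω] {P : Measure Ω} {H : Type*} [NormedAddCommGroup H]
  [InnerProductSpace ℝ H] {X : H → Ω → ℝ}

theorem integral_sq (hX : IsIsometricProcess P X) (f : H) :
    ∫ ω, X f ω ^ 2 ∂P = ‖f‖ ^ 2 := by
  rw [← real_inner_self_eq_norm_sq, ← hX.covariance]
  simp only [pow_two]

theorem inner_toLp (hX : IsIsometricProcess P X) (f g : H) :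
    ⟪(hX.memLp f).toLp (X f), (hX.memLp g).toLp (X g)⟫ = ⟪f, g⟫ := by
  rw [L2.inner_def, ← hX.covariance f g]
  refine integral_congr_ae ?_
  filter_upwards [(hX.memLp f).coeFn_toLp, (hX.memLp g).coeFn_toLp] with ω h1 h2
  rw [h1, h2]
  simp [mul_comm]

/-- The isometry `f ↦ X(f)` from `H` to `L²(P)`. -/
def toLinearIsometry (hX : IsIsometricProcess P X) : H →ₗᵢ[ℝ] Lp ℝ 2 P :=
  LinearMap.isometryOfInner
    { toFun := fun f => (hX.memLp f).toLp (X f)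
      map_add' := fun f g => by
        rw [← sub_eq_zero, ← inner_self_eq_zero (𝕜 := ℝ)]
        simp only [inner_sub_left, inner_sub_right, inner_add_left, inner_add_right, hX.inner_toLp]
        ring
      map_smul' := fun c f => by
        rw [← sub_eq_zero, ← inner_self_eq_zero (𝕜 := ℝ)]
        simp only [inner_sub_left, inner_sub_right, inner_smul_left, inner_smul_right, hX.inner_toLp,
          RingHom.id_apply, conj_trivial]
        ring }
    (fun f g => hX.inner_toLp f g)

theorem toLinearIsometry_apply (hX : IsIsometricProcess P X) (f : H) :
    hX.toLinearIsometry f = (hX.memLp f).toLp (X f) := rfl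

theorem coeFn_toLinearIsometry (hX : IsIsometricProcess P X) (f : H) :
    hX.toLinearIsometry f =ᵐ[P] X f := (hX.memLp f).coeFn_toLp

theorem eLpNorm_eq (hX : IsIsometricProcess P X) (f : H) :
    eLpNorm (X f) 2 P = ENNReal.ofReal ‖f‖ := by
  rw [← hX.toLinearIsometry.norm_map f, toLinearIsometry_apply, Lp.norm_toLp,
    ENNReal.ofReal_toReal (hX.memLp f).2.ne]

theorem add_ae (hX : IsIsometricProcess P X) (f g : H) :
    X (f + g) =ᵐ[P] fun ω => X f ω + X g ω := by
  filter_upwards [hX.coeFn_toLinearIsometry f, hX.coeFn_toLinearIsometry g,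
    hX.coeFn_toLinearIsometry (f + g),
    Lp.coeFn_add (hX.toLinearIsometry f) (hX.toLinearIsometry g)] with ω h1 h2 h3 h4
  rw [← h3, map_add, h4, Pi.add_apply, h1, h2]

theorem smul_ae (hX : IsIsometricProcess P X) (c : ℝ) (f : H) :
    X (c • f) =ᵐ[P] fun ω => c * X f ω := by
  filter_upwards [hX.coeFn_toLinearIsometry f, hX.coeFn_toLinearIsometry (c • f),
    Lp.coeFn_smul c (hX.toLinearIsometry f)] with ω h1 h2 h3
  rw [← h2, map_smul, h3, Pi.smul_apply, h1, smul_eq_mul]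

theorem zero_ae (hX : IsIsometricProcess P X) : X 0 =ᵐ[P] fun _ => 0 := by
  filter_upwards [hX.smul_ae 0 0] with ω h
  rwa [zero_smul, zero_mul] at h

theorem sub_ae (hX : IsIsometricProcess P X) (f g : H) :
    X (f - g) =ᵐ[P] fun ω => X f ω - X g ω := by
  rw [sub_eq_add_neg, ← neg_one_smul ℝ g]
  filter_upwards [hX.add_ae f ((-1 : ℝ) • g), hX.smul_ae (-1) g] with ω h1 h2
  rw [h1, h2]
  ring

theorem sum_ae (hX : IsIsometricProcess P X) {ι : Type*} (s : Finset ι) (f : ι → H) :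
    X (∑ i ∈ s, f i) =ᵐ[P] fun ω => ∑ i ∈ s, X (f i) ω := by
  classical
  induction s using Finset.induction_on with
  | empty => simpa using hX.zero_ae
  | insert a s ha ih =>
    filter_upwards [hX.add_ae (f a) (∑ i ∈ s, f i), ih] with ω h1 h2
    rw [Finset.sum_insert ha, Finset.sum_insert ha, h1, h2]

theorem sum_smul_ae (hX : IsIsometricProcess P X) {ι : Type*} (s : Finset ι) (a : ι → ℝ)
    (f : ι → H) : X (∑ i ∈ s, a i • f i) =ᵐ[P] fun ω => ∑ i ∈ s, a i * X (f i) ω := by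
  have h : ∀ᵐ ω ∂P, ∀ i ∈ s, X (a i • f i) ω = a i * X (f i) ω :=
    (s.eventually_all).2 fun i _ => hX.smul_ae (a i) (f i)
  filter_upwards [hX.sum_ae s (fun i => a i • f i), h] with ω h1 h2
  rw [h1]
  exact Finset.sum_congr rfl h2

/-- This is what reduces joint laws of the family to one-dimensional laws: the resulting vector
stays in any subspace that contains the `f i`. -/
theorem dual_apply_ae (hX : IsIsometricProcess P X) {ι : Type*} [Fintype ι]
    [DecidableEq ι] (f : ι → H) (L : (ι → ℝ) →L[ℝ] ℝ) :
    (fun ω => L fun i => X (f i) ω) =ᵐ[P] X (∑ i, L (Pi.single i 1) • f i) := by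
  filter_upwards [hX.sum_smul_ae Finset.univ (fun i => L (Pi.single i 1)) f] with ω hω
  rw [hω]
  refine (L.toLinearMap.pi_apply_eq_sum_univ _).trans ?_
  refine Finset.sum_congr rfl fun i _ => ?_
  rw [smul_eq_mul, mul_comm, ContinuousLinearMap.coe_coe]
  congr 2
  ext j
  simp [Pi.single_apply, eq_comm]

variable [IsProbabilityMeasure P]

theorem norm_processCharFun_sub_le (hX : IsIsometricProcess P X) (l : ℝ) (f g : H) :
    ‖processCharFun P X l f - processCharFun P X l g‖ ≤ |l| * ‖f - g‖ := by
  refine (norm_integral_exp_I_mul_sub_le (hX.memLp f) (hX.memLp g) l).trans_eq ?_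
  rw [← eLpNorm_congr_ae (hX.sub_ae f g), hX.eLpNorm_eq, ENNReal.toReal_ofReal (norm_nonneg _)]

theorem continuous_processCharFun (hX : IsIsometricProcess P X) (l : ℝ) :
    Continuous (processCharFun P X l) := by
  refine (LipschitzWith.of_dist_le_mul (K := Real.nnabs l) fun f g => ?_).continuous
  rw [dist_eq_norm, dist_eq_norm]
  exact hX.norm_processCharFun_sub_le l f g

theorem processCharFun_zero (hX : IsIsometricProcess P X) (l : ℝ) :
    processCharFun P X l 0 = 1 := by
  rw [processCharFun, integral_congr_ae (g := fun _ => 1)]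
  · simp
  · filter_upwards [hX.zero_ae] with ω h
    simp [h]

end IsIsometricProcess

/-! ### Integrating out an independent variable -/

section Freezing

variable {Ω : Type*} {m m0 : MeasurableSpace Ω} {P : Measure Ω} [IsProbabilityMeasure P]

/-- Freezing lemma: a variable which is independent of the conditioning σ-field may be integrated
out first. -/
theorem integral_mul_exp_sum_of_indep {ι : Type*} [Fintype ι] (hm : m ≤ m0) {Y : ι → Ω → ℝ}
    (hY : ∀ i, Measurable (Y i))
    (hind : Indep m (MeasurableSpace.comap (fun ω i => Y i ω) inferInstance) P)
    {Ψ : ι → Ω → ℝ} (hΨ : ∀ i, Measurable[m] (Ψ i)) {Z : Ω → ℂ} (hZ : Measurable[m] Z) {C : ℝ}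
    (hC : ∀ ω, ‖Z ω‖ ≤ C) (l : ℝ) :
    ∫ ω, Z ω * Complex.exp (Complex.I * (l : ℂ) * ((∑ i, Ψ i ω * Y i ω : ℝ) : ℂ)) ∂P =
      ∫ ω, Z ω * ∫ ω', Complex.exp (Complex.I * (l : ℂ) * ((∑ i, Ψ i ω * Y i ω' : ℝ) : ℂ)) ∂P
        ∂P := by
  let W : Ω → ℂ × (ι → ℝ) := fun ω => (Z ω, fun i => Ψ i ω)
  let V : Ω → ι → ℝ := fun ω i => Y i ω
  have hWm : Measurable[m] W := hZ.prodMk (@measurable_pi_lambda Ω ι _ m _ _ hΨ)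
  have hW : Measurable W := hWm.mono hm le_rfl
  have hV : Measurable V := measurable_pi_lambda _ hY
  have hWV : IndepFun W V P := by
    rw [IndepFun_iff_Indep]
    exact indep_of_indep_of_le_left hind hWm.comap_le
  let F : (ℂ × (ι → ℝ)) × (ι → ℝ) → ℂ := fun p =>
    p.1.1 * Complex.exp (Complex.I * (l : ℂ) * ((∑ i, p.1.2 i * p.2 i : ℝ) : ℂ))
  have hF : Continuous F := by fun_prop
  have hprod := (indepFun_iff_map_prod_eq_prod_map_map hW.aemeasurable hV.aemeasurable).1 hWV
  have hFint : Integrable (fun ω => F (W ω, V ω)) P := by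
    refine Integrable.of_bound (C := C)
      (hF.measurable.comp (hW.prodMk hV)).aestronglyMeasurable (ae_of_all _ fun ω => ?_)
    change ‖_ * _‖ ≤ C
    rw [norm_mul, norm_exp_I_mul_ofReal_mul, mul_one]
    exact hC ω
  have hFint' : Integrable F ((P.map W).prod (P.map V)) := by
    rw [← hprod]
    exact (integrable_map_measure hF.aestronglyMeasurable (hW.prodMk hV).aemeasurable).2 hFint
  have hinner : ∀ w : ℂ × (ι → ℝ), ∫ v, F (w, v) ∂(P.map V) = w.1 * ∫ ω',
      Complex.exp (Complex.I * (l : ℂ) * ((∑ i, w.2 i * Y i ω' : ℝ) : ℂ)) ∂P := by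
    intro w
    rw [integral_map hV.aemeasurable (by fun_prop), ← integral_const_mul]
  calc _ = ∫ ω, F (W ω, V ω) ∂P := rfl
    _ = ∫ p, F p ∂(P.map fun ω => (W ω, V ω)) :=
        (integral_map (hW.prodMk hV).aemeasurable hF.aestronglyMeasurable).symm
    _ = ∫ w, ∫ v, F (w, v) ∂(P.map V) ∂(P.map W) := by rw [hprod, integral_prod _ hFint']
    _ = ∫ ω, ∫ v, F (W ω, v) ∂(P.map V) ∂P :=
        integral_map hW.aemeasurable hFint'.integral_prod_left.aestronglyMeasurable
    _ = _ := integral_congr_ae (ae_of_all _ fun ω => hinner (W ω))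

end Freezing

/-! ### Independence of the past and the future increments -/

section Increments

variable {Ω H : Type*} [NormedAddCommGroup H] [InnerProductSpace ℝ H] [CompleteSpace H]

theorem resolutionFiltration_mono (X : H → Ω → ℝ) (π : ResolutionOfIdentity H) :
    Monotone (resolutionFiltration X π) := by
  refine fun s t hst => iSup_le fun f => ?_
  rw [← π.proj_proj_of_ge hst f]
  exact le_iSup (fun g : H => MeasurableSpace.comap (X (π.proj t g)) inferInstance) (π.proj s f)

theorem measurable_proj (X : H → Ω → ℝ) (π : ResolutionOfIdentity H) (t : unitInterval) (f : H) :
    Measurable[resolutionFiltration X π t] (X (π.proj t f)) :=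
  measurable_iff_comap_le.2
    (le_iSup (fun g : H => MeasurableSpace.comap (X (π.proj t g)) inferInstance) f)

theorem measurable_increment (X : H → Ω → ℝ) (π : ResolutionOfIdentity H) {s t : unitInterval}
    (hst : s ≤ t) (f : H) :
    Measurable[resolutionFiltration X π t] (X (π.increment s t f)) := by
  rw [← π.proj_increment_of_ge hst le_rfl]
  exact measurable_proj X π t _

variable [MeasurableSpace Ω] {P : Measure Ω} {X : H → Ω → ℝ}

theorem IsIsometricProcess.resolutionFiltration_le (hX : IsIsometricProcess P X)
    (π : ResolutionOfIdentity H) (t : unitInterval) :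
    resolutionFiltration X π t ≤ ‹MeasurableSpace Ω› :=
  iSup_le fun f => (hX.measurable (π.proj t f)).comap_le

variable [IsProbabilityMeasure P] {π : ResolutionOfIdentity H}

theorem indepFun_proj_increment (hX : IsIsometricProcess P X)
    (hπ : π ∈ independentResolutions P X) {s t : unitInterval} (hst : s ≤ t) (f g : H) :
    IndepFun (X (π.proj s f)) (X (π.increment s t g)) P := by
  -- The class of resolutions only speaks of strictly increasing times, so `s = 0` and `s = t` are
  -- treated apart; one of the two variables is then almost surely 0.
  by_cases hs : s = 0
  · have h0 : X (π.proj s f) =ᵐ[P] fun _ => 0 := by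
      rw [hs, π.proj_zero]
      exact hX.zero_ae
    exact (indepFun_const_left (0 : ℝ) _).congr h0.symm EventuallyEq.rfl
  by_cases hst' : s = t
  · have h0 : X (π.increment s t g) =ᵐ[P] fun _ => 0 := by
      rw [hst', π.increment_self]
      exact hX.zero_ae
    exact (indepFun_const_right _ (0 : ℝ)).congr EventuallyEq.rfl h0.symm
  have hs0 : 0 < s := unitInterval.pos_iff_ne_zero.2 hs
  have hlt : s < t := lt_of_le_of_ne hst hst'
  -- With `0` as first time, `π_s f` is itself an increment.
  have hmono : StrictMono ![0, s, t] := by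
    refine Fin.strictMono_iff_lt_succ.2 fun i => ?_
    fin_cases i
    · exact hs0
    · exact hlt
  have h := (hπ 2 le_rfl ![f, g] ![0, s, t] hmono).indepFun (zero_ne_one : (0 : Fin 2) ≠ 1)
  simpa [π.proj_zero, ResolutionOfIdentity.increment] using h

/-- By linearity, any linear functional of finitely many past variables is almost surely a single
`X(π_s f)`, and likewise for increments. Independence of such pairs therefore factorizes the joint
characteristic functions, which gives independence of the two whole processes. -/
theorem indep_resolutionFiltration_increment (hX : IsIsometricProcess P X)
    (hπ : π ∈ independentResolutions P X) {s t : unitInterval} (hst : s ≤ t) :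
    Indep (resolutionFiltration X π s)
      (MeasurableSpace.comap (fun ω (g : H) => X (π.increment s t g) ω) inferInstance) P := by
  have hproc : IndepFun (fun ω (f : H) => X (π.proj s f) ω)
      (fun ω (g : H) => X (π.increment s t g) ω) P := by
    refine IndepFun.process_indepFun_process (fun f => hX.measurable _) (fun g => hX.measurable _)
      fun I J => ?_
    classical
    have hI : Measurable fun ω (i : I) => X (π.proj s i) ω :=
      measurable_pi_lambda _ fun i => hX.measurable _
    have hJ : Measurable fun ω (j : J) => X (π.increment s t j) ω :=
      measurable_pi_lambda _ fun j => hX.measurable _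
    rw [indepFun_iff_charFunDual_prod hI.aemeasurable hJ.aemeasurable]
    intro L
    have h1 := hX.dual_apply_ae (fun i : I => π.proj s i) (L.comp (.inl ℝ (I → ℝ) (J → ℝ)))
    have h2 := hX.dual_apply_ae (fun j : J => π.increment s t j)
      (L.comp (.inr ℝ (I → ℝ) (J → ℝ)))
    simp only [← map_smul, ← map_sum] at h1 h2
    simp only [charFunDual_apply]
    rw [integral_map (hI.prodMk hJ).aemeasurable (by fun_prop),
      integral_map hI.aemeasurable (by fun_prop), integral_map hJ.aemeasurable (by fun_prop)]
    have e1 := integral_congr_ae (h1.fun_comp fun x : ℝ => Complex.exp (x * Complex.I))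
    have e2 := integral_congr_ae (h2.fun_comp fun x : ℝ => Complex.exp (x * Complex.I))
    simp only [Function.comp_apply] at e1 e2
    rw [e1, e2]
    have hprod := (indepFun_proj_increment hX hπ hst
      (∑ x : I, (L.comp (.inl ℝ (I → ℝ) (J → ℝ))) (Pi.single x 1) • (x : H))
      (∑ x : J, (L.comp (.inr ℝ (I → ℝ) (J → ℝ))) (Pi.single x 1) • (x : H))
      ).integral_fun_comp_mul_comp
      (f := fun x : ℝ => Complex.exp (x * Complex.I))
      (g := fun x : ℝ => Complex.exp (x * Complex.I)) (hX.measurable _).aemeasurable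
      (hX.measurable _).aemeasurable (by fun_prop) (by fun_prop)
    rw [← hprod]
    refine integral_congr_ae ?_
    filter_upwards [h1, h2] with ω e1 e2
    rw [← e1, ← e2, ← Complex.exp_add, ← add_mul, ← Complex.ofReal_add]
    congr 3
    rw [ContinuousLinearMap.comp_apply, ContinuousLinearMap.comp_apply, ← map_add]
    simp
  rw [IndepFun_iff_Indep] at hproc
  refine indep_of_indep_of_le_left hproc (iSup_le fun f => ?_)
  exact ((measurable_pi_apply f).comp (comap_measurable
    fun ω (f : H) => X (π.proj s f) ω)).comap_le

theorem processCharFun_add_of_indep (hX : IsIsometricProcess P X)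
    (hπ : π ∈ independentResolutions P X) {s t : unitInterval} (hst : s ≤ t) (l : ℝ) (f g : H) :
    processCharFun P X l (π.proj s f + π.increment s t g) =
      processCharFun P X l (π.proj s f) * processCharFun P X l (π.increment s t g) := by
  have h := (indepFun_proj_increment hX hπ hst f g).integral_fun_comp_mul_comp
    (f := fun x : ℝ => Complex.exp (Complex.I * (l : ℂ) * (x : ℂ)))
    (g := fun x : ℝ => Complex.exp (Complex.I * (l : ℂ) * (x : ℂ)))
    (hX.measurable _).aemeasurable (hX.measurable _).aemeasurable
    (by fun_prop) (by fun_prop)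
  rw [processCharFun, processCharFun, processCharFun, ← h]
  refine integral_congr_ae ?_
  filter_upwards [hX.add_ae (π.proj s f) (π.increment s t g)] with ω hω
  rw [hω, ← Complex.exp_add]
  push_cast
  rw [mul_add]

theorem processCharFun_sum_increment (hX : IsIsometricProcess P X)
    (hπ : π ∈ independentResolutions P X) {τ : ℕ → unitInterval} (hτ : Monotone τ) (l : ℝ)
    (f : ℕ → H) (n : ℕ) :
    processCharFun P X l (∑ k ∈ Finset.range n, π.increment (τ k) (τ (k + 1)) (f k)) =
      ∏ k ∈ Finset.range n, processCharFun P X l (π.increment (τ k) (τ (k + 1)) (f k)) := by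
  induction n with
  | zero => simpa using hX.processCharFun_zero l
  | succ n ih =>
    have h : π.proj (τ n) (∑ k ∈ Finset.range n, π.increment (τ k) (τ (k + 1)) (f k)) =
        ∑ k ∈ Finset.range n, π.increment (τ k) (τ (k + 1)) (f k) := by
      rw [map_sum]
      refine Finset.sum_congr rfl fun k hk => ?_
      exact π.proj_increment_of_ge (hτ k.le_succ) (hτ (Finset.mem_range.1 hk)) _
    rw [Finset.sum_range_succ, Finset.prod_range_succ, ← ih, ← h]
    exact processCharFun_add_of_indep hX hπ (hτ n.le_succ) l _ _

end Increments

/-! ### The principle of conditioning for adapted unimodular factors -/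

section Conditioning

variable {Ω : Type*} {m0 : MeasurableSpace Ω} {P : Measure Ω} [IsProbabilityMeasure P]

/-- The product of the normalized factors `E k / c k`, stopped before the modulus of the
product of the conditional factors `c k` falls below `δ`. -/
def stoppedProduct (E c : ℕ → Ω → ℂ) (δ : ℝ) (n : ℕ) (ω : Ω) : ℂ :=
  ∏ k ∈ Finset.range n,
    if δ ≤ ‖∏ j ∈ Finset.range (k + 1), c j ω‖ then E k ω / c k ω else 1

theorem stoppedProduct_succ (E c : ℕ → Ω → ℂ) (δ : ℝ) (n : ℕ) (ω : Ω) :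
    stoppedProduct E c δ (n + 1) ω = stoppedProduct E c δ n ω *
      if δ ≤ ‖∏ j ∈ Finset.range (n + 1), c j ω‖ then E n ω / c n ω else 1 :=
  Finset.prod_range_succ _ _

variable {E c : ℕ → Ω → ℂ} {δ : ℝ}

/-- Since `‖c k‖ ≤ 1`, the partial products decrease in modulus: if the last one is at least `δ`, so
were all the previous ones, and no factor has been replaced by 1. -/
theorem stoppedProduct_mul_prod (hc : ∀ k ω, ‖c k ω‖ ≤ 1) (hδ : 0 < δ) {n : ℕ} {ω : Ω}
    (h : δ ≤ ‖∏ j ∈ Finset.range n, c j ω‖) :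
    stoppedProduct E c δ n ω * ∏ j ∈ Finset.range n, c j ω = ∏ j ∈ Finset.range n, E j ω := by
  induction n with
  | zero => simp [stoppedProduct]
  | succ n ih =>
    have h' := h
    rw [Finset.prod_range_succ, norm_mul] at h'
    have hcn : c n ω ≠ 0 := by
      intro h0
      rw [h0, norm_zero, mul_zero] at h'
      linarith
    have hle : δ ≤ ‖∏ j ∈ Finset.range n, c j ω‖ :=
      h'.trans (mul_le_of_le_one_right (norm_nonneg _) (hc n ω))
    rw [stoppedProduct_succ, if_pos h, Finset.prod_range_succ, Finset.prod_range_succ, ← ih hle]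
    field_simp

/-- While the product is not stopped, its modulus is the inverse of that of a partial product of the
`c k`, which is at least `δ`; afterwards it is frozen. -/
theorem norm_stoppedProduct_le (hE : ∀ k ω, ‖E k ω‖ = 1) (hc : ∀ k ω, ‖c k ω‖ ≤ 1) (hδ : 0 < δ)
    (hδ1 : δ ≤ 1) (n : ℕ) (ω : Ω) : ‖stoppedProduct E c δ n ω‖ ≤ δ⁻¹ := by
  induction n with
  | zero => simpa [stoppedProduct] using (one_le_inv₀ hδ).2 hδ1
  | succ n ih =>
    by_cases h : δ ≤ ‖∏ j ∈ Finset.range (n + 1), c j ω‖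
    · have h1 := congrArg norm (stoppedProduct_mul_prod (E := E) hc hδ h)
      rw [norm_mul, norm_prod (f := fun j => E j ω)] at h1
      simp only [hE, Finset.prod_const_one] at h1
      rw [eq_inv_of_mul_eq_one_left h1]
      exact inv_anti₀ hδ h
    · rwa [stoppedProduct_succ, if_neg h, mul_one]

variable {𝓕 : ℕ → MeasurableSpace Ω}

theorem measurable_prod_of_adapted (h𝓕 : Monotone 𝓕) (hc : ∀ k, Measurable[𝓕 k] (c k)) (n : ℕ) :
    Measurable[𝓕 n] fun ω => ∏ j ∈ Finset.range (n + 1), c j ω :=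
  Finset.measurable_fun_prod (m := 𝓕 n) _ fun j hj =>
    (hc j).mono (h𝓕 (Finset.mem_range_succ_iff.1 hj)) le_rfl

theorem measurableSet_le_norm_prod (h𝓕 : Monotone 𝓕) (hc : ∀ k, Measurable[𝓕 k] (c k)) (n : ℕ) :
    MeasurableSet[𝓕 n] {ω | δ ≤ ‖∏ j ∈ Finset.range (n + 1), c j ω‖} :=
  (measurable_norm.comp (measurable_prod_of_adapted h𝓕 hc n)) measurableSet_Ici

theorem measurable_stoppedProduct (h𝓕 : Monotone 𝓕) (hE : ∀ k, Measurable[𝓕 (k + 1)] (E k))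
    (hc : ∀ k, Measurable[𝓕 k] (c k)) (n : ℕ) : Measurable[𝓕 n] (stoppedProduct E c δ n) := by
  refine Finset.measurable_fun_prod (m := 𝓕 n) _ fun k hk => ?_
  have hk' : k + 1 ≤ n := Finset.mem_range.1 hk
  refine Measurable.ite (m := 𝓕 n)
    (h𝓕 (k.le_succ.trans hk') _ (measurableSet_le_norm_prod h𝓕 hc k)) ?_ measurable_const
  exact Measurable.div (m := 𝓕 n) ((hE k).mono (h𝓕 hk') le_rfl)
    ((hc k).mono (h𝓕 (k.le_succ.trans hk')) le_rfl)

/-- Martingale property: the event of going on at step `n` is `𝓕 n`-measurable, as it involves `c 0,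
…, c n` only. On it `E n` can be replaced by `c n` under the integral, which cancels the
denominator. -/
theorem integral_stoppedProduct (h𝓕 : Monotone 𝓕) (h𝓕0 : ∀ k, 𝓕 k ≤ m0)
    (hE : ∀ k, Measurable[𝓕 (k + 1)] (E k)) (hE1 : ∀ k ω, ‖E k ω‖ = 1)
    (hc : ∀ k, Measurable[𝓕 k] (c k)) (hc1 : ∀ k ω, ‖c k ω‖ ≤ 1)
    (hEc : ∀ (k : ℕ) (Z : Ω → ℂ) (C : ℝ), Measurable[𝓕 k] Z → (∀ ω, ‖Z ω‖ ≤ C) →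
      ∫ ω, Z ω * E k ω ∂P = ∫ ω, Z ω * c k ω ∂P)
    (hδ : 0 < δ) (hδ1 : δ ≤ 1) (n : ℕ) : ∫ ω, stoppedProduct E c δ n ω ∂P = 1 := by
  induction n with
  | zero => simp [stoppedProduct]
  | succ n ih =>
    let S : Set Ω := {ω | δ ≤ ‖∏ j ∈ Finset.range (n + 1), c j ω‖}
    have hSδ : ∀ ω ∈ S, δ ≤ ‖∏ j ∈ Finset.range (n + 1), c j ω‖ := fun _ h => h
    have hSm : MeasurableSet[𝓕 n] S := measurableSet_le_norm_prod h𝓕 hc n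
    have hMm : Measurable[𝓕 n] (stoppedProduct E c δ n) := measurable_stoppedProduct h𝓕 hE hc n
    have hM := norm_stoppedProduct_le hE1 hc1 hδ hδ1
    let Z : Ω → ℂ := S.indicator fun ω => stoppedProduct E c δ n ω / c n ω
    let R : Ω → ℂ := Sᶜ.indicator (stoppedProduct E c δ n)
    have hZm : Measurable[𝓕 n] Z :=
      Measurable.indicator (Measurable.div (m := 𝓕 n) hMm (hc n)) hSm
    have hRm : Measurable[𝓕 n] R := Measurable.indicator hMm hSm.compl
    have hZ : ∀ ω, ‖Z ω‖ ≤ δ⁻¹ := by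
      intro ω
      by_cases hω : ω ∈ S
      · have h1 := hM (n + 1) ω
        rw [stoppedProduct_succ, if_pos (hSδ ω hω), ← mul_div_assoc, mul_div_right_comm, norm_mul, hE1,
          mul_one] at h1
        simpa only [Z, Set.indicator_of_mem hω] using h1
      · simpa only [Z, Set.indicator_of_notMem hω, norm_zero] using inv_nonneg.2 hδ.le
    have hR : ∀ ω, ‖R ω‖ ≤ δ⁻¹ := fun ω => (norm_indicator_le_norm_self _ _).trans (hM n ω)
    have hRi : Integrable R P :=
      .of_bound (hRm.mono (h𝓕0 n) le_rfl).aestronglyMeasurable _ (ae_of_all _ hR)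
    have hZE : Integrable (fun ω => Z ω * E n ω) P := by
      refine .of_bound (((hZm.mono (h𝓕0 n) le_rfl).mul
        ((hE n).mono (h𝓕0 _) le_rfl)).aestronglyMeasurable) δ⁻¹ (ae_of_all _ fun ω => ?_)
      rw [norm_mul, hE1, mul_one]
      exact hZ ω
    have hZc : Integrable (fun ω => Z ω * c n ω) P := by
      refine .of_bound (((hZm.mono (h𝓕0 n) le_rfl).mul
        ((hc n).mono (h𝓕0 _) le_rfl)).aestronglyMeasurable) δ⁻¹ (ae_of_all _ fun ω => ?_)
      rw [norm_mul]
      exact (mul_le_of_le_one_right (norm_nonneg _) (hc1 n ω)).trans (hZ ω)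
    calc ∫ ω, stoppedProduct E c δ (n + 1) ω ∂P = ∫ ω, (Z ω * E n ω + R ω) ∂P := by
          refine integral_congr_ae (ae_of_all _ fun ω => ?_)
          by_cases hω : ω ∈ S
          · have hω' : ω ∉ Sᶜ := fun h => h hω
            simp only [Z, R, Set.indicator_of_mem hω, Set.indicator_of_notMem hω', add_zero]
            rw [stoppedProduct_succ, if_pos (hSδ ω hω)]
            ring
          · have hω' : ω ∈ Sᶜ := hω
            simp only [Z, R, Set.indicator_of_notMem hω, Set.indicator_of_mem hω', zero_mul,
              zero_add]
            rw [stoppedProduct_succ,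
              if_neg (show ¬δ ≤ ‖∏ j ∈ Finset.range (n + 1), c j ω‖ from hω), mul_one]
      _ = ∫ ω, Z ω * c n ω ∂P + ∫ ω, R ω ∂P := by rw [integral_add hZE hRi, hEc n Z _ hZm hZ]
      _ = ∫ ω, stoppedProduct E c δ n ω ∂P := by
          rw [← integral_add hZc hRi]
          refine integral_congr_ae (ae_of_all _ fun ω => ?_)
          by_cases hω : ω ∈ S
          · have hω' : ω ∉ Sᶜ := fun h => h hω
            have hcn : c n ω ≠ 0 := by
              intro h0
              have h1 := hSδ ω hω
              rw [Finset.prod_range_succ, h0, mul_zero, norm_zero] at h1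
              linarith
            simp only [Z, R, Set.indicator_of_mem hω, Set.indicator_of_notMem hω', add_zero]
            exact div_mul_cancel₀ _ hcn
          · have hω' : ω ∈ Sᶜ := hω
            simp only [Z, R, Set.indicator_of_notMem hω, Set.indicator_of_mem hω', zero_mul,
              zero_add]
      _ = 1 := ih

/-- Quantitative principle of conditioning: if the product of the conditional characteristic
functions `c k` is close in `L¹` to the non-zero constant `φ`, then the expectation of the product
of the unimodular variables `E k` is close to `φ`. -/
theorem norm_integral_prod_sub_le (h𝓕 : Monotone 𝓕) (h𝓕0 : ∀ k, 𝓕 k ≤ m0)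
    (hE : ∀ k, Measurable[𝓕 (k + 1)] (E k)) (hE1 : ∀ k ω, ‖E k ω‖ = 1)
    (hc : ∀ k, Measurable[𝓕 k] (c k)) (hc1 : ∀ k ω, ‖c k ω‖ ≤ 1)
    (hEc : ∀ (k : ℕ) (Z : Ω → ℂ) (C : ℝ), Measurable[𝓕 k] Z → (∀ ω, ‖Z ω‖ ≤ C) →
      ∫ ω, Z ω * E k ω ∂P = ∫ ω, Z ω * c k ω ∂P)
    {φ : ℂ} (hφ : φ ≠ 0) (hφ1 : ‖φ‖ ≤ 1) (n : ℕ) :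
    ‖∫ ω, ∏ k ∈ Finset.range n, E k ω ∂P - φ‖ ≤
      6 / ‖φ‖ * ∫ ω, ‖∏ k ∈ Finset.range n, c k ω - φ‖ ∂P := by
  have hφ0 : 0 < ‖φ‖ := norm_pos_iff.2 hφ
  -- With half of `‖φ‖` as level, falling below it forces a distance of at least `δ` from `φ`.
  set δ : ℝ := ‖φ‖ / 2 with hδdef
  have hδ : 0 < δ := by positivity
  have hδ1 : δ ≤ 1 := by linarith
  have hM := norm_stoppedProduct_le hE1 hc1 hδ hδ1 n
  have hMm := (measurable_stoppedProduct (δ := δ) h𝓕 hE hc n).mono (h𝓕0 n) le_rfl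
  have hMi : Integrable (stoppedProduct E c δ n) P :=
    .of_bound hMm.aestronglyMeasurable _ (ae_of_all _ hM)
  have hEm : Measurable fun ω => ∏ k ∈ Finset.range n, E k ω :=
    Finset.measurable_fun_prod _ fun k _ => (hE k).mono (h𝓕0 _) le_rfl
  have hcm : Measurable fun ω => ∏ k ∈ Finset.range n, c k ω :=
    Finset.measurable_fun_prod _ fun k _ => (hc k).mono (h𝓕0 _) le_rfl
  have hEn : ∀ ω, ‖∏ k ∈ Finset.range n, E k ω‖ = 1 := fun ω => by
    rw [norm_prod]
    simp only [hE1, Finset.prod_const_one]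
  have hcn : ∀ ω, ‖∏ k ∈ Finset.range n, c k ω‖ ≤ 1 := fun ω => by
    rw [norm_prod]
    exact Finset.prod_le_one (fun _ _ => norm_nonneg _) fun k _ => hc1 k ω
  have hEi : Integrable (fun ω => ∏ k ∈ Finset.range n, E k ω) P :=
    .of_bound hEm.aestronglyMeasurable _ (ae_of_all _ fun ω => (hEn ω).le)
  have hci : Integrable (fun ω => ∏ k ∈ Finset.range n, c k ω) P :=
    .of_bound hcm.aestronglyMeasurable _ (ae_of_all _ hcn)
  -- The stopped product has mean 1, so `φ` may be replaced by `φ` times it inside the integral. The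
  -- integrands are then compared pointwise.
  have heq : ∫ ω, ∏ k ∈ Finset.range n, E k ω ∂P - φ =
      ∫ ω, (∏ k ∈ Finset.range n, E k ω - φ * stoppedProduct E c δ n ω) ∂P := by
    rw [integral_sub hEi (hMi.const_mul φ), integral_const_mul,
      integral_stoppedProduct h𝓕 h𝓕0 hE hE1 hc hc1 hEc hδ hδ1, mul_one]
  rw [heq, ← integral_const_mul]
  refine norm_integral_le_of_norm_le ((hci.sub (integrable_const φ)).norm.const_mul _)
    (ae_of_all _ fun ω => ?_)
  set A := ∏ k ∈ Finset.range n, c k ω with hA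
  have h6 : 6 / ‖φ‖ = 3 / δ := by
    rw [hδdef]
    field_simp
    norm_num
  change _ ≤ 6 / ‖φ‖ * ‖A - φ‖
  rw [h6, div_mul_eq_mul_div, le_div_iff₀ hδ]
  -- Above the level, the difference is the stopped product times `A - φ`, hence at most `‖A - φ‖ /
  -- δ`. Below it, the difference is at most `1 + ‖φ‖ / δ = 3`, while `‖A - φ‖ ≥ δ`.
  by_cases h : δ ≤ ‖A‖
  · have h1 := stoppedProduct_mul_prod (E := E) hc1 hδ h
    have hA0 : 0 < ‖A‖ := hδ.trans_le h
    have hM' : ‖stoppedProduct E c δ n ω‖ * ‖A‖ = 1 := by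
      rw [← norm_mul, hA, h1, hEn]
    have hle : ‖stoppedProduct E c δ n ω‖ * δ ≤ 1 :=
      (mul_le_mul_of_nonneg_left h (norm_nonneg _)).trans hM'.le
    rw [← h1, ← hA, mul_comm φ, ← mul_sub, norm_mul]
    nlinarith [norm_nonneg (A - φ), norm_nonneg (stoppedProduct E c δ n ω)]
  · have h2 : δ ≤ ‖A - φ‖ := by
      have := norm_sub_norm_le φ A
      rw [norm_sub_rev] at this
      linarith
    have h3 : ‖∏ k ∈ Finset.range n, E k ω - φ * stoppedProduct E c δ n ω‖ ≤ 3 := by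
      refine (norm_sub_le _ _).trans ?_
      rw [hEn, norm_mul]
      have h4 : ‖φ‖ * ‖stoppedProduct E c δ n ω‖ ≤ ‖φ‖ * δ⁻¹ := by
        gcongr
        exact hM ω
      have h5 : ‖φ‖ * δ⁻¹ = 2 := by
        rw [hδdef]
        field_simp
      linarith
    nlinarith [norm_nonneg (∏ k ∈ Finset.range n, E k ω - φ * stoppedProduct E c δ n ω)]

end Conditioning

/-- Finitely many points of a linear order lie on a monotone sequence, within a bounded range. -/
theorem exists_monotone_seq_covering {α : Type*} [LinearOrder α] (T : Finset α)
    (hT : T.Nonempty) : ∃ τ : ℕ → α, Monotone τ ∧ ∃ N : ℕ, ∀ x ∈ T, ∃ k ≤ N, τ k = x := by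
  have hpos : 0 < T.card := hT.card_pos
  refine ⟨fun k => T.orderEmbOfFin rfl ⟨min k (T.card - 1), by omega⟩, fun a b hab => ?_,
    T.card, fun x hx => ?_⟩
  · refine (T.orderEmbOfFin rfl).monotone ?_
    simp only [Fin.mk_le_mk]
    omega
  · have h : x ∈ Set.range (T.orderEmbOfFin rfl) := by
      rw [Finset.range_orderEmbOfFin]
      exact hx
    obtain ⟨i, hi⟩ := h
    refine ⟨i, i.2.le, ?_⟩
    rw [← hi]
    refine congrArg _ (Fin.ext ?_)
    have := i.2
    simp only
    omega

theorem ResolutionOfIdentity.sum_Ico_increment {H : Type*} [NormedAddCommGroup H]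
    [InnerProductSpace ℝ H] [CompleteSpace H] (π : ResolutionOfIdentity H) (τ : ℕ → unitInterval)
    {a b : ℕ} (hab : a ≤ b) :
    ∑ k ∈ Finset.Ico a b, π.increment (τ k) (τ (k + 1)) = π.increment (τ a) (τ b) :=
  Finset.sum_Ico_sub (fun k => π.proj (τ k)) hab

/-! ### Elementary integrands written along a common subdivision -/

namespace ElementaryIntegrand

variable {Ω : Type*} [MeasurableSpace Ω] {P : Measure Ω} {H : Type*}
  [NormedAddCommGroup H] [InnerProductSpace ℝ H] [CompleteSpace H] {X : H → Ω → ℝ}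
  {π : ResolutionOfIdentity H}

/-- A subdivision of the unit interval that contains the times of an elementary integrand. -/
structure Subdivision (e : ElementaryIntegrand P X π) where
  τ : ℕ → unitInterval
  mono : Monotone τ
  N : ℕ
  a : Fin e.n → ℕ
  b : Fin e.n → ℕ
  τ_a : ∀ i, τ (a i) = e.s i
  τ_b : ∀ i, τ (b i) = e.t i
  b_le : ∀ i, b i ≤ N

theorem exists_subdivision (e : ElementaryIntegrand P X π) : Nonempty e.Subdivision := by
  classical
  obtain ⟨τ, hτ, N, hN⟩ := exists_monotone_seq_covering
    -- The point `0` keeps the set of times nonempty even when the integrand has no term.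
    (insert 0 (Finset.univ.image e.s ∪ Finset.univ.image e.t)) (Finset.insert_nonempty _ _)
  have hs : ∀ i, ∃ k ≤ N, τ k = e.s i := fun i => hN _ (by simp)
  have ht : ∀ i, ∃ k ≤ N, τ k = e.t i := fun i => hN _ (by simp)
  choose a _ ha using hs
  choose b hb hb' using ht
  exact ⟨⟨τ, hτ, N, a, b, ha, hb', hb⟩⟩

namespace Subdivision

variable {e : ElementaryIntegrand P X π} (d : e.Subdivision)

theorem a_le_b (i : Fin e.n) : d.a i ≤ d.b i := by
  by_contra h
  have h1 := d.mono (not_le.1 h).le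
  rw [d.τ_a, d.τ_b] at h1
  exact absurd (e.lt i) (not_lt.2 h1)

/-- The coefficient of the `i`-th term on the `k`-th interval of the subdivision. -/
def coeff (k : ℕ) (i : Fin e.n) : Ω → ℝ :=
  if k ∈ Finset.Ico (d.a i) (d.b i) then e.Φ i else 0

/-- A coefficient is nonzero only on intervals starting at or after `s i`, so refining the
subdivision preserves measurability with respect to the past. -/
theorem measurable_coeff (k : ℕ) (i : Fin e.n) :
    Measurable[resolutionFiltration X π (d.τ k)] (d.coeff k i) := by
  unfold coeff
  split_ifs with h
  · refine (e.measurable i).mono (resolutionFiltration_mono X π ?_) le_rfl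
    rw [← d.τ_a]
    exact d.mono (Finset.mem_Ico.1 h).1
  · exact measurable_const

theorem memLp_coeff (k : ℕ) (i : Fin e.n) : MemLp (d.coeff k i) 2 P := by
  unfold coeff
  split_ifs with h
  · exact e.memLp i
  · exact MemLp.zero

/-- The projection attached to the `k`-th interval of the subdivision. -/
def incr (k : ℕ) : H →L[ℝ] H := π.increment (d.τ k) (d.τ (k + 1))

theorem sum_coeff_smul {E : Type*} [AddCommGroup E] [Module ℝ E] (g : ℕ → E) (i : Fin e.n)
    (ω : Ω) : ∑ k ∈ Finset.range d.N, d.coeff k i ω • g k =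
      e.Φ i ω • ∑ k ∈ Finset.Ico (d.a i) (d.b i), g k := by
  rw [Finset.smul_sum]
  have hsub : Finset.Ico (d.a i) (d.b i) ⊆ Finset.range d.N := fun k hk =>
    Finset.mem_range.2 ((Finset.mem_Ico.1 hk).2.trans_le (d.b_le i))
  rw [← Finset.sum_subset hsub]
  · refine Finset.sum_congr rfl fun k hk => ?_
    rw [coeff, if_pos hk]
  · intro k _ hk
    rw [coeff, if_neg hk, Pi.zero_apply, zero_smul]

theorem sum_incr (i : Fin e.n) (f : H) : ∑ k ∈ Finset.Ico (d.a i) (d.b i), d.incr k f =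
    (π.proj (e.t i) - π.proj (e.s i)) f := by
  have h := congrArg (fun A : H →L[ℝ] H => A f) (π.sum_Ico_increment d.τ (d.a_le_b i))
  rw [d.τ_a, d.τ_b] at h
  simp only [sum_apply] at h
  exact h

theorem toFun_eq (ω : Ω) : e.toFun ω =
    ∑ k ∈ Finset.range d.N, ∑ i, d.coeff k i ω • d.incr k (e.f i) := by
  rw [Finset.sum_comm]
  refine Finset.sum_congr rfl fun i _ => ?_
  rw [d.sum_coeff_smul (fun k => d.incr k (e.f i)), d.sum_incr]

theorem integral_ae (hX : IsIsometricProcess P X) : e.integral =ᵐ[P] fun ω =>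
    ∑ k ∈ Finset.range d.N, ∑ i, d.coeff k i ω * X (d.incr k (e.f i)) ω := by
  have h : ∀ᵐ ω ∂P, ∀ i, X ((π.proj (e.t i) - π.proj (e.s i)) (e.f i)) ω =
      ∑ k ∈ Finset.Ico (d.a i) (d.b i), X (d.incr k (e.f i)) ω := by
    rw [ae_all_iff]
    intro i
    rw [← d.sum_incr]
    exact hX.sum_ae _ _
  filter_upwards [h] with ω hω
  rw [Finset.sum_comm]
  refine Finset.sum_congr rfl fun i _ => ?_
  simp only [← smul_eq_mul]
  rw [d.sum_coeff_smul (fun k => X (d.incr k (e.f i)) ω), hω]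

end Subdivision

theorem memLp_toFun (e : ElementaryIntegrand P X π) : MemLp e.toFun 2 P := by
  refine memLp_finsetSum _ fun i _ => ?_
  exact (ContinuousLinearMap.toSpanSingleton ℝ
    ((π.proj (e.t i) - π.proj (e.s i)) (e.f i))).comp_memLp' (e.memLp i)

variable [IsProbabilityMeasure P]

/-- Conditionally on the past, the increments of the integral of an elementary integrand have the
characteristic function of the increments of `X`. -/
theorem Subdivision.integral_mul_exp (hX : IsIsometricProcess P X)
    (hπ : π ∈ independentResolutions P X) {e : ElementaryIntegrand P X π} (d : e.Subdivision)
    (l : ℝ) (k : ℕ) {Z : Ω → ℂ} {C : ℝ}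
    (hZ : Measurable[resolutionFiltration X π (d.τ k)] Z) (hC : ∀ ω, ‖Z ω‖ ≤ C) :
    ∫ ω, Z ω * Complex.exp (Complex.I * (l : ℂ) *
        ((∑ i, d.coeff k i ω * X (d.incr k (e.f i)) ω : ℝ) : ℂ)) ∂P =
      ∫ ω, Z ω * processCharFun P X l (∑ i, d.coeff k i ω • d.incr k (e.f i)) ∂P := by
  have hind : Indep (resolutionFiltration X π (d.τ k))
      (MeasurableSpace.comap (fun ω (i : Fin e.n) => X (d.incr k (e.f i)) ω) inferInstance) P := by
    refine indep_of_indep_of_le_right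
      (indep_resolutionFiltration_increment hX hπ (d.mono k.le_succ)) ?_
    have hm : Measurable fun (x : H → ℝ) (i : Fin e.n) => x (e.f i) := by fun_prop
    exact (hm.comp (comap_measurable
      fun ω (g : H) => X (π.increment (d.τ k) (d.τ (k + 1)) g) ω)).comap_le
  rw [integral_mul_exp_sum_of_indep (hX.resolutionFiltration_le π _) (fun i => hX.measurable _)
    hind (d.measurable_coeff k) hZ hC l]
  refine integral_congr_ae (ae_of_all _ fun ω => ?_)
  simp only
  congr 1
  refine integral_congr_ae ?_
  filter_upwards [hX.sum_smul_ae Finset.univ (fun i => d.coeff k i ω)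
    (fun i => d.incr k (e.f i))] with ω' hω'
  rw [hω']

/-- The principle of conditioning applied along a subdivision. For fixed `ω` the integrand is a
deterministic sum of increments, so independence of increments turns the product of the conditional
characteristic functions into `processCharFun` of the whole integrand. -/
theorem norm_charFun_integral_sub_le (hX : IsIsometricProcess P X)
    (hπ : π ∈ independentResolutions P X) (e : ElementaryIntegrand P X π) (l : ℝ) {φ : ℂ}
    (hφ : φ ≠ 0) (hφ1 : ‖φ‖ ≤ 1) :
    ‖∫ ω, Complex.exp (Complex.I * (l : ℂ) * (e.integral ω : ℂ)) ∂P - φ‖ ≤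
      6 / ‖φ‖ * ∫ ω, ‖processCharFun P X l (e.toFun ω) - φ‖ ∂P := by
  obtain ⟨d⟩ := e.exists_subdivision
  have h := norm_integral_prod_sub_le (P := P)
    (𝓕 := fun k => resolutionFiltration X π (d.τ k))
    (E := fun k ω => Complex.exp (Complex.I * (l : ℂ) *
      ((∑ i, d.coeff k i ω * X (d.incr k (e.f i)) ω : ℝ) : ℂ)))
    (c := fun k ω => processCharFun P X l (∑ i, d.coeff k i ω • d.incr k (e.f i)))
    (fun a b hab => resolutionFiltration_mono X π (d.mono hab))
    (fun k => hX.resolutionFiltration_le π _) ?_ (fun k ω => norm_exp_I_mul_ofReal_mul l _) ?_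
    (fun k ω => norm_processCharFun_le P X l _)
    (fun k Z C hZ hC => d.integral_mul_exp hX hπ l k hZ hC) hφ hφ1 d.N
  · have h1 : ∫ ω, Complex.exp (Complex.I * (l : ℂ) * (e.integral ω : ℂ)) ∂P =
        ∫ ω, ∏ k ∈ Finset.range d.N, Complex.exp (Complex.I * (l : ℂ) *
          ((∑ i, d.coeff k i ω * X (d.incr k (e.f i)) ω : ℝ) : ℂ)) ∂P := by
      refine integral_congr_ae ?_
      filter_upwards [d.integral_ae hX] with ω hω
      rw [hω, ← Complex.exp_sum, ← Finset.mul_sum]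
      push_cast
      rfl
    have h2 : ∀ ω, processCharFun P X l (e.toFun ω) = ∏ k ∈ Finset.range d.N,
        processCharFun P X l (∑ i, d.coeff k i ω • d.incr k (e.f i)) := by
      intro ω
      rw [d.toFun_eq]
      have h3 := processCharFun_sum_increment hX hπ d.mono l
        (fun k => ∑ i, d.coeff k i ω • e.f i) d.N
      simp only [map_sum, map_smul] at h3
      exact h3
    rw [h1]
    simp only [h2]
    exact h
  · intro k
    have hsum : Measurable[resolutionFiltration X π (d.τ (k + 1))]
        fun ω => ∑ i, d.coeff k i ω * X (d.incr k (e.f i)) ω := by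
      refine Finset.measurable_fun_sum (m := resolutionFiltration X π (d.τ (k + 1))) _ fun i _ => ?_
      exact Measurable.mul (m := resolutionFiltration X π (d.τ (k + 1)))
        ((d.measurable_coeff k i).mono (resolutionFiltration_mono X π (d.mono k.le_succ)) le_rfl)
        (measurable_increment X π (d.mono k.le_succ) _)
    exact (by fun_prop : Continuous fun y : ℝ =>
      Complex.exp (Complex.I * (l : ℂ) * (y : ℂ))).measurable.comp hsum
  · intro k
    have hc : Continuous fun a : Fin e.n → ℝ =>
        processCharFun P X l (∑ i, a i • d.incr k (e.f i)) :=
      (hX.continuous_processCharFun l).comp (by fun_prop)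
    exact hc.measurable.comp (@measurable_pi_lambda Ω (Fin e.n) _
      (resolutionFiltration X π (d.τ k)) _ _ (d.measurable_coeff k))

end ElementaryIntegrand

/-! ### The Itô isometry -/

section Isometry

variable {Ω : Type*} [MeasurableSpace Ω] {P : Measure Ω} [IsProbabilityMeasure P] {H : Type*}
  [NormedAddCommGroup H] [InnerProductSpace ℝ H] [CompleteSpace H] {X : H → Ω → ℝ}
  {π : ResolutionOfIdentity H}

theorem indepFun_of_measurable_increments (hX : IsIsometricProcess P X)
    (hπ : π ∈ independentResolutions P X) {s t : unitInterval} (hst : s ≤ t) {A : Ω → ℝ}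
    (hA : Measurable[resolutionFiltration X π s] A) {G : (H → ℝ) → ℝ} (hG : Measurable G) :
    IndepFun A (fun ω => G fun g => X (π.increment s t g) ω) P := by
  rw [IndepFun_iff_Indep]
  refine indep_of_indep_of_le_left (indep_of_indep_of_le_right
    (indep_resolutionFiltration_increment hX hπ hst) ?_) hA.comap_le
  exact (hG.comp (comap_measurable fun ω (g : H) => X (π.increment s t g) ω)).comap_le

/-- The square is a product of two independent integrable variables; independence replaces any
boundedness of `Φ`. -/
theorem memLp_mul_increment (hX : IsIsometricProcess P X)
    (hπ : π ∈ independentResolutions P X) {s t : unitInterval} (hst : s ≤ t) {Φ : Ω → ℝ}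
    (hΦ : Measurable[resolutionFiltration X π s] Φ) (hΦ2 : MemLp Φ 2 P) (f : H) :
    MemLp (fun ω => Φ ω * X (π.increment s t f) ω) 2 P := by
  have hm : AEStronglyMeasurable (fun ω => Φ ω * X (π.increment s t f) ω) P :=
    hΦ2.1.mul (hX.memLp _).1
  rw [memLp_two_iff_integrable_sq hm]
  have hind := indepFun_of_measurable_increments hX hπ hst (A := fun ω => Φ ω ^ 2)
    ((measurable_id.pow_const 2).comp hΦ)
    (G := fun x => x f ^ 2) (by fun_prop)
  refine (hind.integrable_mul hΦ2.integrable_sq (hX.memLp _).integrable_sq).congr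
    (ae_of_all _ fun ω => ?_)
  simp only [Pi.mul_apply]
  ring

theorem integral_mul_increment_same (hX : IsIsometricProcess P X)
    (hπ : π ∈ independentResolutions P X) {s t : unitInterval} (hst : s ≤ t) {Φ Φ' : Ω → ℝ}
    (hΦ : Measurable[resolutionFiltration X π s] Φ)
    (hΦ' : Measurable[resolutionFiltration X π s] Φ') (f f' : H) :
    ∫ ω, (Φ ω * X (π.increment s t f) ω) * (Φ' ω * X (π.increment s t f') ω) ∂P =
      ∫ ω, Φ ω * Φ' ω * ⟪π.increment s t f, π.increment s t f'⟫ ∂P := by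
  have hind := indepFun_of_measurable_increments hX hπ hst (A := fun ω => Φ ω * Φ' ω)
    (Measurable.mul (m := resolutionFiltration X π s) hΦ hΦ')
    (G := fun x => x f * x f') (by fun_prop)
  have hle := hX.resolutionFiltration_le π s
  have h := hind.integral_fun_mul_eq_mul_integral
    ((hΦ.mono hle le_rfl).mul (hΦ'.mono hle le_rfl)).aestronglyMeasurable
    ((hX.measurable _).mul (hX.measurable _)).aestronglyMeasurable
  rw [integral_mul_const, ← hX.covariance, ← h]
  refine integral_congr_ae (ae_of_all _ fun ω => ?_)
  simp only
  ring

theorem integral_mul_increment_of_le (hX : IsIsometricProcess P X)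
    (hπ : π ∈ independentResolutions P X) {s t s' t' : unitInterval} (hst : s ≤ t)
    (hts' : t ≤ s') (hst' : s' ≤ t') {Φ Φ' : Ω → ℝ}
    (hΦ : Measurable[resolutionFiltration X π s] Φ)
    (hΦ' : Measurable[resolutionFiltration X π s'] Φ') (f f' : H) :
    ∫ ω, (Φ ω * X (π.increment s t f) ω) * (Φ' ω * X (π.increment s' t' f') ω) ∂P = 0 := by
  have hA : Measurable[resolutionFiltration X π s']
      fun ω => Φ ω * X (π.increment s t f) ω * Φ' ω := by
    refine Measurable.mul (m := resolutionFiltration X π s')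
      (Measurable.mul (m := resolutionFiltration X π s') ?_ ?_) hΦ'
    · exact hΦ.mono (resolutionFiltration_mono X π (hst.trans hts')) le_rfl
    · exact (measurable_increment X π hst f).mono (resolutionFiltration_mono X π hts') le_rfl
  have hind := indepFun_of_measurable_increments hX hπ hst' hA
    (G := fun x => x f') (by fun_prop)
  -- The product formula for independent factors requires no integrability of `Φ * X * Φ'`; the
  -- centered later increment makes the product vanish.
  have h := hind.integral_fun_mul_eq_mul_integral
    (hA.mono (hX.resolutionFiltration_le π s') le_rfl).aestronglyMeasurable
    (hX.measurable _).aestronglyMeasurable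
  rw [hX.centered, mul_zero] at h
  rw [← h]
  refine integral_congr_ae (ae_of_all _ fun ω => ?_)
  simp only
  ring

namespace ElementaryIntegrand

variable {e : ElementaryIntegrand P X π}

/-- On distinct intervals both sides vanish, on the left by centering of the later increment and on
the right by orthogonality. On the same interval, independence and the covariance of `X` identify
them. -/
theorem Subdivision.integral_mul_eq_inner (hX : IsIsometricProcess P X)
    (hπ : π ∈ independentResolutions P X) (d : e.Subdivision) (p q : ℕ × Fin e.n) :
    ∫ ω, (d.coeff p.1 p.2 ω * X (d.incr p.1 (e.f p.2)) ω) *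
        (d.coeff q.1 q.2 ω * X (d.incr q.1 (e.f q.2)) ω) ∂P =
      ∫ ω, ⟪d.coeff p.1 p.2 ω • d.incr p.1 (e.f p.2), d.coeff q.1 q.2 ω • d.incr q.1 (e.f q.2)⟫
        ∂P := by
  obtain ⟨k, i⟩ := p
  obtain ⟨m, j⟩ := q
  simp only [inner_smul_left, inner_smul_right, conj_trivial]
  rcases lt_trichotomy k m with h | rfl | h
  · refine (integral_mul_increment_of_le hX hπ (d.mono k.le_succ) (d.mono h) (d.mono m.le_succ)
      (d.measurable_coeff k i) (d.measurable_coeff m j) _ _).trans ?_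
    have h0 : ⟪d.incr k (e.f i), d.incr m (e.f j)⟫ = 0 :=
      π.inner_increment_increment_of_le (d.mono k.le_succ) (d.mono h) (d.mono m.le_succ) _ _
    simp [h0]
  · refine (integral_mul_increment_same hX hπ (d.mono k.le_succ)
      (d.measurable_coeff k i) (d.measurable_coeff k j) _ _).trans ?_
    refine integral_congr_ae (ae_of_all _ fun ω => ?_)
    simp only [Subdivision.incr]
    ring
  · have h0 : ⟪d.incr k (e.f i), d.incr m (e.f j)⟫ = 0 := by
      rw [real_inner_comm]
      exact π.inner_increment_increment_of_le (d.mono m.le_succ) (d.mono h) (d.mono k.le_succ) _ _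
    simp only [h0, mul_zero, integral_zero]
    simp only [mul_comm (d.coeff k i _ * _)]
    exact integral_mul_increment_of_le hX hπ (d.mono m.le_succ) (d.mono h) (d.mono k.le_succ)
      (d.measurable_coeff m j) (d.measurable_coeff k i) _ _

theorem memLp_integral (hX : IsIsometricProcess P X) (hπ : π ∈ independentResolutions P X)
    (e : ElementaryIntegrand P X π) : MemLp e.integral 2 P :=
  memLp_finsetSum _ fun i _ =>
    memLp_mul_increment hX hπ (e.lt i).le (e.measurable i) (e.memLp i) (e.f i)

/-- The Itô isometry for elementary integrands. -/
theorem integral_sq_integral (hX : IsIsometricProcess P X)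
    (hπ : π ∈ independentResolutions P X) (e : ElementaryIntegrand P X π) :
    ∫ ω, e.integral ω ^ 2 ∂P = ∫ ω, ‖e.toFun ω‖ ^ 2 ∂P := by
  obtain ⟨d⟩ := e.exists_subdivision
  let T : Finset (ℕ × Fin e.n) := Finset.range d.N ×ˢ Finset.univ
  let Y : ℕ × Fin e.n → Ω → ℝ := fun p ω => d.coeff p.1 p.2 ω * X (d.incr p.1 (e.f p.2)) ω
  let V : ℕ × Fin e.n → Ω → H := fun p ω => d.coeff p.1 p.2 ω • d.incr p.1 (e.f p.2)
  have hY : ∀ p, MemLp (Y p) 2 P := fun p =>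
    memLp_mul_increment hX hπ (d.mono p.1.le_succ) (d.measurable_coeff p.1 p.2)
      (d.memLp_coeff p.1 p.2) (e.f p.2)
  have hV : ∀ p, MemLp (V p) 2 P := fun p =>
    (ContinuousLinearMap.toSpanSingleton ℝ (d.incr p.1 (e.f p.2))).comp_memLp'
      (d.memLp_coeff p.1 p.2)
  have h1 : ∫ ω, e.integral ω ^ 2 ∂P = ∫ ω, ∑ p ∈ T, ∑ q ∈ T, Y p ω * Y q ω ∂P := by
    refine integral_congr_ae ?_
    filter_upwards [d.integral_ae hX] with ω hω
    rw [hω, ← Finset.sum_mul_sum, ← pow_two, Finset.sum_product]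
  have h2 : ∫ ω, ‖e.toFun ω‖ ^ 2 ∂P = ∫ ω, ∑ p ∈ T, ∑ q ∈ T, ⟪V p ω, V q ω⟫ ∂P := by
    refine integral_congr_ae (ae_of_all _ fun ω => ?_)
    simp only
    rw [d.toFun_eq, ← real_inner_self_eq_norm_sq, ← Finset.sum_product', sum_inner]
    refine Finset.sum_congr rfl fun p _ => ?_
    rw [inner_sum]
  have hYi : ∀ p q, Integrable (fun ω => Y p ω * Y q ω) P := fun p q =>
    (hY p).integrable_mul (hY q)
  have hVi : ∀ p q, Integrable (fun ω => ⟪V p ω, V q ω⟫) P := fun p q =>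
    ((hV p).norm.integrable_mul (hV q).norm).mono ((hV p).1.inner (hV q).1)
      (ae_of_all _ fun ω => by simpa using abs_real_inner_le_norm (V p ω) (V q ω))
  rw [h1, h2, integral_finsetSum _ fun p _ => integrable_finsetSum _ fun q _ => hYi p q,
    integral_finsetSum _ fun p _ => integrable_finsetSum _ fun q _ => hVi p q]
  refine Finset.sum_congr rfl fun p _ => ?_
  rw [integral_finsetSum _ fun q _ => hYi p q, integral_finsetSum _ fun q _ => hVi p q]
  exact Finset.sum_congr rfl fun q _ => d.integral_mul_eq_inner hX hπ p q

theorem eLpNorm_integral (hX : IsIsometricProcess P X) (hπ : π ∈ independentResolutions P X)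
    (e : ElementaryIntegrand P X π) : eLpNorm e.integral 2 P = eLpNorm e.toFun 2 P := by
  rw [(e.memLp_integral hX hπ).eLpNorm_eq_integral_rpow_norm (by norm_num) (by norm_num),
    e.memLp_toFun.eLpNorm_eq_integral_rpow_norm (by norm_num) (by norm_num)]
  simp only [ENNReal.toReal_ofNat, Real.rpow_two, Real.norm_eq_abs, sq_abs]
  rw [e.integral_sq_integral hX hπ]

end ElementaryIntegrand

end Isometry

/-- Subdivisions of the unit interval along which the increments of `t ↦ π_t f` are small. -/
theorem ResolutionOfIdentity.exists_subdivision_norm_increment_le {H : Type*}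
    [NormedAddCommGroup H] [InnerProductSpace ℝ H] [CompleteSpace H] (π : ResolutionOfIdentity H)
    (f : H) {ε : ℝ} (hε : 0 < ε) :
    ∃ τ : ℕ → unitInterval, Monotone τ ∧ ∃ N : ℕ, τ 0 = 0 ∧ τ N = 1 ∧
      ∀ k, ‖π.increment (τ k) (τ (k + 1)) f‖ ≤ ε := by
  -- Cover the compact interval by the open sets where `π_t f` stays within `ε / 2` of some `π_i f`;
  -- a fine enough subdivision has each of its intervals in one of them.
  have hopen : ∀ i : unitInterval, IsOpen {t | ‖π.proj t f - π.proj i f‖ < ε / 2} := fun i =>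
    isOpen_lt ((π.continuous_proj_apply f).sub continuous_const).norm continuous_const
  obtain ⟨τ, h0, hmono, ⟨N, hN⟩, hc⟩ := exists_monotone_Icc_subset_open_cover_unitInterval hopen
    (fun t _ => Set.mem_iUnion.2 ⟨t, by simpa using half_pos hε⟩)
  refine ⟨τ, hmono, N, h0, hN N le_rfl, fun k => ?_⟩
  obtain ⟨i, hi⟩ := hc k
  have h1 : ‖π.proj (τ k) f - π.proj i f‖ < ε / 2 :=
    hi (Set.left_mem_Icc.2 (hmono k.le_succ))
  have h2 : ‖π.proj (τ (k + 1)) f - π.proj i f‖ < ε / 2 :=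
    hi (Set.right_mem_Icc.2 (hmono k.le_succ))
  rw [increment_apply, ← sub_sub_sub_cancel_right _ _ (π.proj i f)]
  exact (norm_sub_le _ _).trans (by linarith)

theorem ResolutionOfIdentity.sum_increment_eq {H : Type*} [NormedAddCommGroup H]
    [InnerProductSpace ℝ H] [CompleteSpace H] (π : ResolutionOfIdentity H) {τ : ℕ → unitInterval}
    {N : ℕ} (h0 : τ 0 = 0) (hN : τ N = 1) (x : H) :
    ∑ k ∈ Finset.range N, π.increment (τ k) (τ (k + 1)) x = x := by
  simp only [increment_apply]
  rw [Finset.sum_range_sub (fun k => π.proj (τ k) x), h0, hN, π.proj_zero, π.proj_one]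
  simp

theorem ResolutionOfIdentity.sum_sq_norm_increment {H : Type*} [NormedAddCommGroup H]
    [InnerProductSpace ℝ H] [CompleteSpace H] (π : ResolutionOfIdentity H) {τ : ℕ → unitInterval}
    (hτ : Monotone τ) {N : ℕ} (h0 : τ 0 = 0) (hN : τ N = 1) (x : H) :
    ∑ k ∈ Finset.range N, ‖π.increment (τ k) (τ (k + 1)) x‖ ^ 2 = ‖x‖ ^ 2 := by
  simp only [← π.inner_increment_increment (hτ (Nat.le_succ _))]
  rw [← inner_sum, π.sum_increment_eq h0 hN, real_inner_self_eq_norm_sq]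

/-! ### The vector space of elementary integrands -/

namespace ElementaryIntegrand

variable {Ω : Type*} [MeasurableSpace Ω] {P : Measure Ω} {H : Type*} [NormedAddCommGroup H]
  [InnerProductSpace ℝ H] [CompleteSpace H] {X : H → Ω → ℝ} {π : ResolutionOfIdentity H}

/-- The elementary integrand with one term. -/
def single {s t : unitInterval} (hst : s < t) {Φ : Ω → ℝ}
    (hΦ : Measurable[resolutionFiltration X π s] Φ) (hΦ2 : MemLp Φ 2 P) (f : H) :
    ElementaryIntegrand P X π where
  n := 1
  s _ := s
  t _ := t
  lt _ := hst
  f _ := f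
  Φ _ := Φ
  measurable _ := hΦ
  memLp _ := hΦ2

/-- The empty elementary integrand. -/
protected def zero : ElementaryIntegrand P X π where
  n := 0
  s := Fin.elim0
  t := Fin.elim0
  lt i := i.elim0
  f := Fin.elim0
  Φ := Fin.elim0
  measurable i := i.elim0
  memLp i := i.elim0

/-- The concatenation of two elementary integrands. -/
protected def add (e e' : ElementaryIntegrand P X π) : ElementaryIntegrand P X π where
  n := e.n + e'.n
  s := Fin.append e.s e'.s
  t := Fin.append e.t e'.t
  lt i := by
    refine Fin.addCases (fun i => ?_) (fun i => ?_) i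
    · simpa using e.lt i
    · simpa using e'.lt i
  f := Fin.append e.f e'.f
  Φ := Fin.append e.Φ e'.Φ
  measurable i := by
    refine Fin.addCases (fun i => ?_) (fun i => ?_) i
    · rw [Fin.append_left, Fin.append_left]
      exact e.measurable i
    · rw [Fin.append_right, Fin.append_right]
      exact e'.measurable i
  memLp i := by
    refine Fin.addCases (fun i => ?_) (fun i => ?_) i
    · rw [Fin.append_left]
      exact e.memLp i
    · rw [Fin.append_right]
      exact e'.memLp i

/-- A scalar multiple of an elementary integrand. -/
protected def smul (c : ℝ) (e : ElementaryIntegrand P X π) : ElementaryIntegrand P X π where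
  n := e.n
  s := e.s
  t := e.t
  lt := e.lt
  f := e.f
  Φ i ω := c * e.Φ i ω
  measurable i := (measurable_const_mul c).comp (e.measurable i)
  memLp i := (e.memLp i).const_mul c

theorem toFun_single {s t : unitInterval} (hst : s < t) {Φ : Ω → ℝ}
    (hΦ : Measurable[resolutionFiltration X π s] Φ) (hΦ2 : MemLp Φ 2 P) (f : H) (ω : Ω) :
    (single hst hΦ hΦ2 f).toFun ω = Φ ω • π.increment s t f :=
  Finset.sum_singleton _ _

theorem toFun_zero (ω : Ω) : (ElementaryIntegrand.zero : ElementaryIntegrand P X π).toFun ω = 0 :=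
  Finset.sum_empty

theorem toFun_add (e e' : ElementaryIntegrand P X π) (ω : Ω) :
    (e.add e').toFun ω = e.toFun ω + e'.toFun ω := by
  refine (Fin.sum_univ_add _).trans ?_
  simp only [ElementaryIntegrand.add, Fin.append_left, Fin.append_right]
  rfl

theorem integral_add (e e' : ElementaryIntegrand P X π) (ω : Ω) :
    (e.add e').integral ω = e.integral ω + e'.integral ω := by
  refine (Fin.sum_univ_add _).trans ?_
  simp only [ElementaryIntegrand.add, Fin.append_left, Fin.append_right]
  rfl

theorem toFun_smul (c : ℝ) (e : ElementaryIntegrand P X π) (ω : Ω) :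
    (e.smul c).toFun ω = c • e.toFun ω := by
  simp only [toFun, ElementaryIntegrand.smul, Finset.smul_sum, smul_smul]
  rfl

theorem integral_smul (c : ℝ) (e : ElementaryIntegrand P X π) (ω : Ω) :
    (e.smul c).integral ω = c * e.integral ω := by
  simp only [integral, ElementaryIntegrand.smul, Finset.mul_sum, mul_assoc]
  rfl

theorem adapted (e : ElementaryIntegrand P X π) (t : unitInterval) (h : H) :
    Measurable[resolutionFiltration X π t] fun ω => ⟪e.toFun ω, π.proj t h⟫ := by
  simp only [toFun, sum_inner, inner_smul_left, conj_trivial]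
  refine Finset.measurable_fun_sum (m := resolutionFiltration X π t) _ fun i _ => ?_
  by_cases hi : e.s i ≤ t
  · exact (measurable_mul_const _).comp
      ((e.measurable i).mono (resolutionFiltration_mono X π hi) le_rfl)
  · have h0 : ⟪(π.proj (e.t i) - π.proj (e.s i)) (e.f i), π.proj t h⟫ = 0 := by
      rw [← π.inner_proj_left]
      have := π.proj_increment_of_le (e.lt i).le (not_le.1 hi).le (e.f i)
      rw [ResolutionOfIdentity.increment] at this
      rw [this, inner_zero_left]
    simp only [h0, mul_zero]
    exact measurable_const

variable (P X π) in
/-- The subspace of `L²(P; H)` of the classes of the elementary integrands. -/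
def submodule : Submodule ℝ (Lp H 2 P) where
  carrier := {v | ∃ e : ElementaryIntegrand P X π, v =ᵐ[P] e.toFun}
  zero_mem' := ⟨.zero, by
    filter_upwards [Lp.coeFn_zero H 2 P] with ω h
    rw [h, toFun_zero, Pi.zero_apply]⟩
  add_mem' := by
    rintro v w ⟨e, he⟩ ⟨e', he'⟩
    refine ⟨e.add e', ?_⟩
    filter_upwards [he, he', Lp.coeFn_add v w] with ω h1 h2 h3
    rw [h3, Pi.add_apply, h1, h2, toFun_add]
  smul_mem' := by
    rintro c v ⟨e, he⟩
    refine ⟨e.smul c, ?_⟩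
    filter_upwards [he, Lp.coeFn_smul c v] with ω h1 h2
    rw [h2, Pi.smul_apply, h1, toFun_smul]

end ElementaryIntegrand

/-! ### Density of elementary integrands and existence of the integral -/

section Density

variable {Ω : Type*} [MeasurableSpace Ω] {P : Measure Ω} {H : Type*}
  [NormedAddCommGroup H] [InnerProductSpace ℝ H] [CompleteSpace H] {X : H → Ω → ℝ}
  {π : ResolutionOfIdentity H}

/-- Adaptedness to the filtration generated by a resolution of the identity. -/
def IsResolutionAdapted (P : Measure Ω) (X : H → Ω → ℝ) (π : ResolutionOfIdentity H)
    (u : Ω → H) : Prop :=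
  ∀ (t : unitInterval) (h : H),
    AEStronglyMeasurable[resolutionFiltration X π t] (fun ω => ⟪u ω, π.proj t h⟫) P

/-- Each condition is the preimage, under the continuous map `v ↦ ⟪π_t h, v⟫`, of the closed set of
`L²` classes with an `F_t`-measurable version. -/
theorem isClosed_setOf_isResolutionAdapted (hX : IsIsometricProcess P X)
    (π : ResolutionOfIdentity H) : IsClosed {v : Lp H 2 P | IsResolutionAdapted P X π v} := by
  simp only [IsResolutionAdapted, Set.ofPred_forall]
  refine isClosed_iInter fun t => isClosed_iInter fun h => ?_
  have hT := ((innerSL ℝ (π.proj t h)).compLpL 2 P).continuous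
  have hcl := (isClosed_aestronglyMeasurable (F := ℝ) (p := 2) (μ := P)
    (hX.resolutionFiltration_le π t)).preimage hT
  convert hcl using 1
  ext v
  refine aestronglyMeasurable_congr ?_
  filter_upwards [(innerSL ℝ (π.proj t h)).coeFn_compLpL (p := 2) (μ := P) v] with ω hω
  rw [hω, innerSL_apply_apply, real_inner_comm]

theorem IsResolutionAdapted.of_mem_topologicalClosure (hX : IsIsometricProcess P X)
    {v : Lp H 2 P} (hv : v ∈ (ElementaryIntegrand.submodule P X π).topologicalClosure) :
    IsResolutionAdapted P X π v := by
  refine closure_minimal ?_ (isClosed_setOf_isResolutionAdapted hX π) hv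
  rintro w ⟨e, he⟩ t h
  refine (e.adapted t h).stronglyMeasurable.aestronglyMeasurable.congr ?_
  filter_upwards [he] with ω hω
  rw [hω]

/-- An adapted `w` which is orthogonal to the elementary integrands has, along every `f`, a
martingale `⟪w, π_t f⟫` of vanishing quadratic variation. -/
theorem inner_ae_eq_zero_of_mem_orthogonal {w : Lp H 2 P}
    (hw : IsResolutionAdapted P X π w) (hort : w ∈ (ElementaryIntegrand.submodule P X π)ᗮ)
    (f : H) : (fun ω => ⟪f, w ω⟫) =ᵐ[P] 0 := by
  have hwm : MemLp w 2 P := Lp.memLp w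
  have hinner : ∀ g : H, MemLp (fun ω => ⟪g, w ω⟫) 2 P := fun g => hwm.const_inner g
  -- Orthogonality of martingale increments: the earlier increment is a legitimate coefficient `Φ`
  -- on the later interval, and `w` is orthogonal to the resulting one-term elementary integrand.
  have hcross : ∀ {s t s' t' : unitInterval}, s ≤ t → t ≤ s' → s' ≤ t' →
      ∫ ω, ⟪π.increment s t f, w ω⟫ * ⟪π.increment s' t' f, w ω⟫ ∂P = 0 := by
    intro s t s' t' hst hts' hst'
    rcases hst'.eq_or_lt with rfl | hlt
    · simp [π.increment_self]
    have had : AEStronglyMeasurable[resolutionFiltration X π s']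
        (fun ω => ⟪π.increment s t f, w ω⟫) P := by
      have := hw s' (π.increment s t f)
      rw [π.proj_increment_of_ge hst hts'] at this
      refine this.congr (ae_of_all _ fun ω => ?_)
      exact real_inner_comm _ _
    -- Elementary coefficients must be genuinely measurable, hence the passage to a measurable
    -- version.
    have hmk := had.ae_eq_mk
    have hΦ2 : MemLp (had.mk _) 2 P := (hinner _).ae_eq hmk
    let e := ElementaryIntegrand.single (P := P) (X := X) (π := π) hlt
      had.stronglyMeasurable_mk.measurable hΦ2 f
    have hz := (Submodule.mem_orthogonal _ _).1 hort (e.memLp_toFun.toLp e.toFun)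
      ⟨e, e.memLp_toFun.coeFn_toLp⟩
    rw [L2.inner_def] at hz
    rw [← hz]
    refine integral_congr_ae ?_
    filter_upwards [hmk, e.memLp_toFun.coeFn_toLp] with ω h1 h2
    rw [h2, ElementaryIntegrand.toFun_single, inner_smul_left, conj_trivial, ← h1]
  have hbound : ∀ ε : ℝ, 0 < ε → ∫ ω, ⟪f, w ω⟫ ^ 2 ∂P ≤ ε ^ 2 * ∫ ω, ‖w ω‖ ^ 2 ∂P := by
    intro ε hε
    obtain ⟨τ, hτ, N, h0, hN, hle⟩ := π.exists_subdivision_norm_increment_le f hε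
    let M : ℕ → Ω → ℝ := fun k ω => ⟪π.increment (τ k) (τ (k + 1)) f, w ω⟫
    have hM : ∀ k, MemLp (M k) 2 P := fun k => hinner _
    have hMM : ∀ j k, Integrable (fun ω => M j ω * M k ω) P := fun j k =>
      (hM j).integrable_mul (hM k)
    have hne : ∀ j k, j ≠ k → ∫ ω, M j ω * M k ω ∂P = 0 := by
      intro j k hjk
      rcases hjk.lt_or_gt with h | h
      · exact hcross (hτ j.le_succ) (hτ h) (hτ k.le_succ)
      · simp only [mul_comm (M j _)]
        exact hcross (hτ k.le_succ) (hτ h) (hτ j.le_succ)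
    calc ∫ ω, ⟪f, w ω⟫ ^ 2 ∂P
        = ∫ ω, ∑ j ∈ Finset.range N, ∑ k ∈ Finset.range N, M j ω * M k ω ∂P := by
          refine integral_congr_ae (ae_of_all _ fun ω => ?_)
          simp only [M]
          rw [← Finset.sum_mul_sum, ← sum_inner, π.sum_increment_eq h0 hN, pow_two]
      _ = ∑ j ∈ Finset.range N, ∫ ω, M j ω ^ 2 ∂P := by
          rw [integral_finsetSum _ fun j _ => integrable_finsetSum _ fun k _ => hMM j k]
          refine Finset.sum_congr rfl fun j hj => ?_
          rw [integral_finsetSum _ fun k _ => hMM j k, Finset.sum_eq_single_of_mem j hj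
            fun k _ hk => hne j k hk.symm]
          simp only [pow_two]
      _ = ∫ ω, ∑ j ∈ Finset.range N, M j ω ^ 2 ∂P :=
          (integral_finsetSum _ fun j _ => (hM j).integrable_sq).symm
      _ ≤ ∫ ω, ε ^ 2 * ‖w ω‖ ^ 2 ∂P := by
          refine integral_mono (integrable_finsetSum _ fun j _ => (hM j).integrable_sq)
            ((hwm.integrable_norm_pow two_ne_zero).const_mul _) fun ω => ?_
          simp only
          rw [← π.sum_sq_norm_increment hτ h0 hN (w ω), Finset.mul_sum]
          refine Finset.sum_le_sum fun k _ => ?_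
          rw [← mul_pow, ← sq_abs]
          refine pow_le_pow_left₀ (abs_nonneg _) ?_ 2
          -- Projecting `w` as well before applying Cauchy-Schwarz keeps the factor `‖Δ_k w‖`, whose
          -- squares sum to `‖w‖²`; the other factor is at most `ε`.
          have h1 : M k ω = ⟪π.increment (τ k) (τ (k + 1)) f,
              π.increment (τ k) (τ (k + 1)) (w ω)⟫ := by
            rw [← π.inner_increment_left, π.increment_increment (hτ k.le_succ)]
          rw [h1]
          exact (abs_real_inner_le_norm _ _).trans
            (mul_le_mul_of_nonneg_right (hle k) (norm_nonneg _))
      _ = ε ^ 2 * ∫ ω, ‖w ω‖ ^ 2 ∂P := integral_const_mul _ _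
  have hlim : Tendsto (fun ε : ℝ => ε ^ 2 * ∫ ω, ‖w ω‖ ^ 2 ∂P) (𝓝[>] 0) (𝓝 0) := by
    have : Tendsto (fun ε : ℝ => ε ^ 2 * ∫ ω, ‖w ω‖ ^ 2 ∂P) (𝓝 0)
        (𝓝 (0 ^ 2 * ∫ ω, ‖w ω‖ ^ 2 ∂P)) := (by fun_prop : Continuous _).tendsto 0
    rw [zero_pow two_ne_zero, zero_mul] at this
    exact this.mono_left nhdsWithin_le_nhds
  have hzero : ∫ ω, ⟪f, w ω⟫ ^ 2 ∂P = 0 := by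
    refine le_antisymm (ge_of_tendsto hlim ?_) (integral_nonneg fun ω => sq_nonneg _)
    filter_upwards [self_mem_nhdsWithin] with ε hε using hbound ε hε
  rw [integral_eq_zero_iff_of_nonneg (fun ω => sq_nonneg _) (hinner f).integrable_sq] at hzero
  filter_upwards [hzero] with ω hω
  exact pow_eq_zero_iff two_ne_zero |>.1 hω

/-- Project `u` onto the closure. The residual is orthogonal to elementary integrands and still
adapted, because adaptedness is a closed condition; its inner product with every `f` then vanishes,
and separability makes it zero. -/
theorem IsAdaptedL2.mem_topologicalClosure [TopologicalSpace.SeparableSpace H]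
    (hX : IsIsometricProcess P X) {u : Ω → H} (hu : IsAdaptedL2 P X π u) :
    hu.memLp.toLp u ∈ (ElementaryIntegrand.submodule P X π).topologicalClosure := by
  set K := (ElementaryIntegrand.submodule P X π).topologicalClosure with hK
  have : CompleteSpace K := (Submodule.isClosed_topologicalClosure _).completeSpace_coe
  set U := hu.memLp.toLp u with hU
  set v : Lp H 2 P := K.starProjection U with hv
  have hvK : v ∈ K := K.starProjection_apply_mem U
  have hva : IsResolutionAdapted P X π v := .of_mem_topologicalClosure hX hvK
  have hwa : IsResolutionAdapted P X π (U - v : Lp H 2 P) := by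
    intro t h
    refine ((hu.adapted t h).sub (hva t h)).congr ?_
    filter_upwards [Lp.coeFn_sub U v, hu.memLp.coeFn_toLp] with ω h1 h2
    rw [Pi.sub_apply, h1, Pi.sub_apply, inner_sub_left, hU, h2]
  have hort : U - v ∈ (ElementaryIntegrand.submodule P X π)ᗮ :=
    Submodule.orthogonal_le (Submodule.le_topologicalClosure _)
      (K.sub_starProjection_mem_orthogonal U)
  have h0 : (U - v : Lp H 2 P) =ᵐ[P] 0 :=
    ae_eq_zero_of_forall_inner (𝕜 := ℝ) fun f =>
      inner_ae_eq_zero_of_mem_orthogonal hwa hort f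
  have h1 : U - v = 0 := (Lp.eq_zero_iff_ae_eq_zero).2 h0
  rw [sub_eq_zero.1 h1]
  exact hvK

variable [IsProbabilityMeasure P]

/-- Adapted square integrable random elements can be integrated. -/
theorem IsAdaptedL2.exists_isItoIntegral [TopologicalSpace.SeparableSpace H]
    (hX : IsIsometricProcess P X) (hπ : π ∈ independentResolutions P X) {u : Ω → H}
    (hu : IsAdaptedL2 P X π u) : ∃ J, IsItoIntegral P X π u J := by
  obtain ⟨v, hv, hlim⟩ := mem_closure_iff_seq_limit.1 (hu.mem_topologicalClosure hX)
  choose e he using hv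
  let I : ℕ → Lp ℝ 2 P := fun k => ((e k).memLp_integral hX hπ).toLp (e k).integral
  -- The isometry for the elementary integrand `e j - e k`; hence the integrals inherit the Cauchy
  -- property.
  have hdist : ∀ j k, dist (I j) (I k) = dist (v j) (v k) := by
    intro j k
    rw [Lp.dist_def, Lp.dist_def]
    congr 1
    let d := (e j).add ((e k).smul (-1))
    have h1 : (I j - I k : Ω → ℝ) =ᵐ[P] d.integral := by
      filter_upwards [((e j).memLp_integral hX hπ).coeFn_toLp,
        ((e k).memLp_integral hX hπ).coeFn_toLp] with ω h2 h3
      rw [Pi.sub_apply, h2, h3, ElementaryIntegrand.integral_add, ElementaryIntegrand.integral_smul]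
      ring
    have h4 : (v j - v k : Ω → H) =ᵐ[P] d.toFun := by
      filter_upwards [he j, he k] with ω h5 h6
      rw [Pi.sub_apply, h5, h6, ElementaryIntegrand.toFun_add, ElementaryIntegrand.toFun_smul,
        neg_one_smul, sub_eq_add_neg]
    rw [eLpNorm_congr_ae h1, eLpNorm_congr_ae h4, d.eLpNorm_integral hX hπ]
  have hcauchy : CauchySeq I := by
    have h := hlim.cauchySeq
    rw [Metric.cauchySeq_iff] at h ⊢
    simpa only [hdist] using h
  obtain ⟨J, hJ⟩ := cauchySeq_tendsto_of_complete hcauchy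
  refine ⟨J, Lp.memLp J, e, ?_, ?_⟩
  · rw [Lp.tendsto_Lp_iff_tendsto_eLpNorm'] at hlim
    refine hlim.congr fun k => eLpNorm_congr_ae ?_
    filter_upwards [he k, hu.memLp.coeFn_toLp] with ω h1 h2
    rw [Pi.sub_apply, h1, h2]
  · rw [Lp.tendsto_Lp_iff_tendsto_eLpNorm'] at hJ
    refine hJ.congr fun k => eLpNorm_congr_ae ?_
    filter_upwards [((e k).memLp_integral hX hπ).coeFn_toLp] with ω h1
    rw [Pi.sub_apply, h1]

end Density

/-! ### Vague compactness on the line -/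

section VagueCompactness

/-- Bounded sequences of finite measures on the line have cluster points for the vague topology. -/
theorem exists_vague_cluster_point (G : ℕ → FiniteMeasure ℝ) (C : NNReal)
    (hG : ∀ n, (G n).mass ≤ C) :
    ∃ (Q : Measure ℝ) (𝓤 : Filter ℕ), IsFiniteMeasure Q ∧ 𝓤.NeBot ∧ 𝓤 ≤ atTop ∧
      ∀ g : ℝ → ℂ, Continuous g → Tendsto g (cocompact ℝ) (𝓝 0) →
        Tendsto (fun n => ∫ x, g x ∂(G n : Measure ℝ)) 𝓤 (𝓝 (∫ x, g x ∂Q)) := by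
  -- On the one-point compactification, measures of bounded mass form a compact set; mass escaping
  -- from `ℝ` is collected at infinity.
  let _ : MeasurableSpace (OnePoint ℝ) := borel _
  have : BorelSpace (OnePoint ℝ) := ⟨rfl⟩
  have hemb : MeasurableEmbedding ((↑) : ℝ → OnePoint ℝ) :=
    OnePoint.isOpenEmbedding_coe.measurableEmbedding
  have hcoe : Measurable ((↑) : ℝ → OnePoint ℝ) := hemb.measurable
  let G' : ℕ → FiniteMeasure (OnePoint ℝ) := fun n => (G n).map ((↑) : ℝ → OnePoint ℝ)
  have hG' : ∀ n, G' n ∈ {μ : FiniteMeasure (OnePoint ℝ) | μ.mass ≤ C} := fun n => by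
    have h : (G' n).mass = (G n).mass := by
      simp only [G', FiniteMeasure.mass]
      rw [FiniteMeasure.map_apply _ hcoe MeasurableSet.univ, Set.preimage_univ]
    change (G' n).mass ≤ C
    rw [h]
    exact hG n
  obtain ⟨R, -, hR⟩ := (isCompact_setOfPred_finiteMeasure_le_of_compactSpace (OnePoint ℝ)
    C).ultrafilter_le_nhds' ((hyperfilter ℕ).map G') (Ultrafilter.mem_map.2 (Filter.univ_mem' hG'))
  refine ⟨(R : Measure (OnePoint ℝ)).comap (↑), hyperfilter ℕ,
    ⟨?_⟩, inferInstance, Nat.hyperfilter_le_atTop, fun g hg hg0 => ?_⟩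
  · rw [hemb.comap_apply]
    exact measure_lt_top _ _
  · let g' : OnePoint ℝ → ℂ := fun x => x.elim 0 g
    have hg' : Continuous g' := by
      rw [OnePoint.continuous_iff, coclosedCompact_eq_cocompact]
      exact ⟨hg0, hg⟩
    let b : BoundedContinuousFunction (OnePoint ℝ) ℂ := .mkOfCompact ⟨g', hg'⟩
    have h := (FiniteMeasure.tendsto_iff_forall_integral_rclike_tendsto ℂ).1
      (show Tendsto G' (hyperfilter ℕ) (𝓝 R) from hR) b
    have hl : ∀ n, ∫ x, b x ∂(G' n : Measure (OnePoint ℝ)) = ∫ x, g x ∂(G n : Measure ℝ) :=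
      fun n => by
        rw [FiniteMeasure.toMeasure_map, hemb.integral_map]
        rfl
    -- An atom of `R` at infinity is invisible, since the extended function vanishes there.
    have hr : ∫ x, b x ∂(R : Measure (OnePoint ℝ)) =
        ∫ x, g x ∂((R : Measure (OnePoint ℝ)).comap ((↑) : ℝ → OnePoint ℝ)) := by
      rw [← setIntegral_eq_integral_of_forall_compl_eq_zero
        (s := Set.range ((↑) : ℝ → OnePoint ℝ)), ← hemb.map_comap, hemb.integral_map]
      · rfl
      · intro x hx
        rw [OnePoint.notMem_range_coe_iff] at hx
        rw [hx]
        rfl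
    simp only [hl, hr] at h
    exact h

end VagueCompactness

/-! ### Kolmogorov's kernel -/

section Kernel

/-- Kolmogorov's kernel `(e^{ilx} - 1 - ilx) / x²`. -/
def kolmogorovKernel (l x : ℝ) : ℂ :=
  if x = 0 then -((l : ℂ) ^ 2 / 2) else
    (Complex.exp (Complex.I * (l : ℂ) * (x : ℂ)) - 1 - Complex.I * (l : ℂ) * (x : ℂ)) / (x : ℂ) ^ 2

theorem sq_mul_kolmogorovKernel (l x : ℝ) : (x : ℂ) ^ 2 * kolmogorovKernel l x =
    Complex.exp (Complex.I * (l : ℂ) * (x : ℂ)) - 1 - Complex.I * (l : ℂ) * (x : ℂ) := by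
  unfold kolmogorovKernel
  split_ifs with h
  · simp [h]
  · have : (x : ℂ) ^ 2 ≠ 0 := by simpa using h
    rw [mul_div_cancel₀ _ this]

theorem norm_exp_sub_one_sub_le_linear (l x : ℝ) :
    ‖Complex.exp (Complex.I * (l : ℂ) * (x : ℂ)) - 1 - Complex.I * (l : ℂ) * (x : ℂ)‖ ≤
      2 * |l| * |x| := by
  have h := norm_exp_I_mul_sub_exp_I_mul_le l x 0
  simp only [Complex.ofReal_zero, mul_zero, Complex.exp_zero, sub_zero] at h
  refine (norm_sub_le _ _).trans ?_
  simp only [norm_mul, Complex.norm_I, one_mul, Complex.norm_real, Real.norm_eq_abs]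
  linarith

theorem norm_exp_sub_one_sub_le_sq (l x : ℝ) :
    ‖Complex.exp (Complex.I * (l : ℂ) * (x : ℂ)) - 1 - Complex.I * (l : ℂ) * (x : ℂ)‖ ≤
      2 * l ^ 2 * x ^ 2 := by
  have hn : ‖Complex.I * (l : ℂ) * (x : ℂ)‖ = |l| * |x| := by simp
  have h2 : (|l| * |x|) ^ 2 = l ^ 2 * x ^ 2 := by rw [mul_pow, sq_abs, sq_abs]
  rcases le_total (|l| * |x|) 1 with h | h
  · have := Complex.norm_exp_sub_one_sub_id_le (hn.trans_le h)
    rw [hn, h2] at this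
    nlinarith [sq_nonneg (l * x)]
  · have := norm_exp_sub_one_sub_le_linear l x
    nlinarith

/-- Taylor's expansion to third order; it shows that the value `-l²/2` at the origin is the one that
makes the kernel continuous. -/
theorem norm_kolmogorovKernel_add_le (l x : ℝ) (h : |l| * |x| ≤ 1) :
    ‖kolmogorovKernel l x - kolmogorovKernel l 0‖ ≤ |l| ^ 3 * |x| := by
  by_cases hx : x = 0
  · simp [hx]
  have hx0 : 0 < |x| := abs_pos.2 hx
  have hxC : (x : ℂ) ≠ 0 := by exact_mod_cast hx
  have hn : ‖Complex.I * (l : ℂ) * (x : ℂ)‖ = |l| * |x| := by simp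
  have hb := Complex.exp_bound (hn.trans_le h) (n := 3) (by norm_num)
  rw [hn] at hb
  simp only [Finset.sum_range_succ, Finset.sum_range_zero, pow_zero, pow_one, Nat.factorial] at hb
  norm_num at hb
  have heq : kolmogorovKernel l x - kolmogorovKernel l 0 =
      (Complex.exp (Complex.I * (l : ℂ) * (x : ℂ)) - (1 + Complex.I * (l : ℂ) * (x : ℂ) +
        (Complex.I * (l : ℂ) * (x : ℂ)) ^ 2 / 2)) / (x : ℂ) ^ 2 := by
    rw [kolmogorovKernel, kolmogorovKernel, if_neg hx, if_pos rfl, mul_pow, mul_pow, Complex.I_sq]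
    field_simp
    ring
  rw [heq, norm_div, norm_pow, Complex.norm_real, Real.norm_eq_abs, div_le_iff₀ (by positivity)]
  refine hb.trans ?_
  have h3 : |l| ^ 3 * |x| * |x| ^ 2 = (|l| * |x|) ^ 3 := by ring
  rw [h3]
  nlinarith [pow_nonneg (mul_nonneg (abs_nonneg l) (abs_nonneg x)) 3]

theorem continuous_kolmogorovKernel (l : ℝ) : Continuous (kolmogorovKernel l) := by
  rw [continuous_iff_continuousAt]
  intro x
  by_cases hx : x = 0
  · rw [hx, ContinuousAt, tendsto_iff_norm_sub_tendsto_zero]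
    have h0 : Tendsto (fun x : ℝ => |l| ^ 3 * |x|) (𝓝 0) (𝓝 0) := by
      have : Tendsto (fun x : ℝ => |l| ^ 3 * |x|) (𝓝 0) (𝓝 (|l| ^ 3 * |(0 : ℝ)|)) :=
        (by fun_prop : Continuous fun x : ℝ => |l| ^ 3 * |x|).tendsto 0
      simpa using this
    refine squeeze_zero' (Eventually.of_forall fun _ => norm_nonneg _) ?_ h0
    have h1 : ∀ᶠ x : ℝ in 𝓝 0, |l| * |x| < 1 :=
      (by fun_prop : Continuous fun x : ℝ => |l| * |x|).continuousAt.eventually_lt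
        continuousAt_const (by simp)
    filter_upwards [h1] with x hx using norm_kolmogorovKernel_add_le l x hx.le
  · have hxC : (x : ℂ) ^ 2 ≠ 0 := by simpa using hx
    have hc : ContinuousAt (fun x : ℝ => (Complex.exp (Complex.I * (l : ℂ) * (x : ℂ)) - 1 -
        Complex.I * (l : ℂ) * (x : ℂ)) / (x : ℂ) ^ 2) x :=
      ContinuousAt.div (by fun_prop) (by fun_prop) hxC
    refine hc.congr ?_
    filter_upwards [isOpen_ne.mem_nhds hx] with y hy
    rw [kolmogorovKernel, if_neg hy]

/-- The numerator grows at most linearly, so the kernel is `O(1/|x|)`. Vanishing at infinity makes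
it a test function for vague limits, and no tightness is needed. -/
theorem tendsto_kolmogorovKernel_cocompact (l : ℝ) :
    Tendsto (kolmogorovKernel l) (cocompact ℝ) (𝓝 0) := by
  have hlim : Tendsto (fun x : ℝ => 2 * |l| * ‖x‖⁻¹) (cocompact ℝ) (𝓝 0) := by
    simpa using (tendsto_inv_atTop_zero.comp (tendsto_norm_cocompact_atTop (E := ℝ))).const_mul
      (2 * |l|)
  refine squeeze_zero_norm' ?_ hlim
  have hne : ∀ᶠ x : ℝ in cocompact ℝ, x ≠ 0 := by
    simpa using (isCompact_singleton (x := (0 : ℝ))).compl_mem_cocompact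
  filter_upwards [hne] with x hx
  have hx0 : 0 < |x| := abs_pos.2 hx
  rw [kolmogorovKernel, if_neg hx, norm_div, norm_pow, Complex.norm_real, Real.norm_eq_abs,
    div_le_iff₀ (by positivity)]
  refine (norm_exp_sub_one_sub_le_linear l x).trans_eq ?_
  field_simp

theorem norm_kolmogorovKernel_le (l x : ℝ) : ‖kolmogorovKernel l x‖ ≤ 2 * l ^ 2 := by
  by_cases hx : x = 0
  · rw [kolmogorovKernel, if_pos hx, norm_neg, norm_div, norm_pow, Complex.norm_real,
      Real.norm_eq_abs, sq_abs, Complex.norm_ofNat]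
    nlinarith [sq_nonneg l]
  · rw [kolmogorovKernel, if_neg hx, norm_div, norm_pow, Complex.norm_real, Real.norm_eq_abs,
      sq_abs, div_le_iff₀ (by positivity)]
    exact norm_exp_sub_one_sub_le_sq l x

end Kernel

/-! ### Comparison with accompanying compound Poisson laws -/

section CompoundPoisson

theorem norm_exp_sub_one_le_one {a : ℂ} (ha : ‖a‖ ≤ 1) : ‖Complex.exp (a - 1)‖ ≤ 1 := by
  rw [Complex.norm_exp, Real.exp_le_one_iff, Complex.sub_re, Complex.one_re]
  linarith [Complex.re_le_norm a]

/-- For `‖a - 1‖ ≤ 1` this is the second-order remainder of the exponential; otherwise both terms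
have modulus at most 1 and the right side is at least 2. -/
theorem norm_sub_exp_sub_one_le {a : ℂ} (ha : ‖a‖ ≤ 1) :
    ‖a - Complex.exp (a - 1)‖ ≤ 2 * ‖a - 1‖ ^ 2 := by
  rcases le_total ‖a - 1‖ 1 with h | h
  · have h1 := Complex.norm_exp_sub_one_sub_id_le h
    rw [norm_sub_rev, show Complex.exp (a - 1) - a = Complex.exp (a - 1) - 1 - (a - 1) by ring]
    nlinarith [sq_nonneg ‖a - 1‖]
  · have h1 := norm_sub_le a (Complex.exp (a - 1))
    have h2 := norm_exp_sub_one_le_one ha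
    nlinarith

/-- The accompanying law estimate. -/
theorem norm_prod_sub_exp_sum_le {ι : Type*} (s : Finset ι) {a : ι → ℂ} (ha : ∀ i, ‖a i‖ ≤ 1) :
    ‖∏ i ∈ s, a i - Complex.exp (∑ i ∈ s, (a i - 1))‖ ≤ ∑ i ∈ s, 2 * ‖a i - 1‖ ^ 2 := by
  classical
  induction s using Finset.induction_on with
  | empty => simp
  | insert j s hj ih =>
    rw [Finset.prod_insert hj, Finset.sum_insert hj, Finset.sum_insert hj, Complex.exp_add]
    have h1 : ‖Complex.exp (∑ i ∈ s, (a i - 1))‖ ≤ 1 := by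
      rw [Complex.exp_sum, norm_prod]
      exact Finset.prod_le_one (fun _ _ => norm_nonneg _) fun i _ => norm_exp_sub_one_le_one (ha i)
    have h2 : a j * ∏ i ∈ s, a i - Complex.exp (a j - 1) * Complex.exp (∑ i ∈ s, (a i - 1)) =
        a j * (∏ i ∈ s, a i - Complex.exp (∑ i ∈ s, (a i - 1))) +
          (a j - Complex.exp (a j - 1)) * Complex.exp (∑ i ∈ s, (a i - 1)) := by ring
    rw [h2, add_comm (2 * _)]
    refine (norm_add_le _ _).trans (add_le_add ?_ ?_)
    · rw [norm_mul]
      exact (mul_le_of_le_one_left (norm_nonneg _) (ha j)).trans ih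
    · rw [norm_mul]
      exact (mul_le_of_le_one_right (norm_nonneg _) h1).trans (norm_sub_exp_sub_one_le (ha j))

end CompoundPoisson

/-! ### Existence of the Lévy-Khintchine pair -/

section LevyKhintchine

/-- The Lévy measure `x⁻² Q(dx)` on `ℝ \ {0}` attached to Kolmogorov's measure `Q`. -/
def levyMeasure (Q : Measure ℝ) : Measure ℝ :=
  (Q.restrict {0}ᶜ).withDensity fun x => ENNReal.ofReal ((x ^ 2)⁻¹)

theorem levyMeasure_singleton_zero (Q : Measure ℝ) : levyMeasure Q {0} = 0 := by
  refine withDensity_absolutelyContinuous _ _ ?_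
  rw [Measure.restrict_apply (measurableSet_singleton _)]
  simp

theorem lintegral_sq_levyMeasure_le (Q : Measure ℝ) :
    ∫⁻ x, ENNReal.ofReal (x ^ 2) ∂(levyMeasure Q) ≤ Q Set.univ := by
  rw [levyMeasure, lintegral_withDensity_eq_lintegral_mul _ (by fun_prop) (by fun_prop)]
  calc _ ≤ ∫⁻ _, 1 ∂(Q.restrict {0}ᶜ) := by
        refine lintegral_mono fun x => ?_
        rw [Pi.mul_apply, ← ENNReal.ofReal_mul (by positivity), ENNReal.ofReal_le_one]
        by_cases hx : x = 0
        · simp [hx]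
        · rw [inv_mul_cancel₀ (by positivity)]
    _ ≤ Q Set.univ := by
        rw [lintegral_one, Measure.restrict_apply_univ]
        exact measure_mono (Set.subset_univ _)

/-- The atom of `Q` at the origin produces the Gaussian term, as the kernel equals `-l²/2` there;
elsewhere the density `x⁻²` absorbs the denominator of the kernel. -/
theorem integral_levyMeasure (Q : Measure ℝ) [IsFiniteMeasure Q] (l : ℝ) :
    -(((Q.real {0} : ℝ) : ℂ) * (l : ℂ) ^ 2 / 2) + ∫ x, (Complex.exp (Complex.I * (l : ℂ) * (x : ℂ))
        - 1 - Complex.I * (l : ℂ) * (x : ℂ)) ∂(levyMeasure Q) = ∫ x, kolmogorovKernel l x ∂Q := by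
  have hint : Integrable (kolmogorovKernel l) Q :=
    .of_bound (continuous_kolmogorovKernel l).aestronglyMeasurable _
      (ae_of_all _ (norm_kolmogorovKernel_le l))
  rw [← integral_add_compl (measurableSet_singleton (0 : ℝ)) hint]
  congr 1
  · rw [integral_singleton, kolmogorovKernel, if_pos rfl, Complex.real_smul]
    ring
  · rw [levyMeasure, integral_withDensity_eq_integral_toReal_smul (by fun_prop)
      (ae_of_all _ fun x => ENNReal.ofReal_lt_top)]
    refine setIntegral_congr_fun (measurableSet_singleton _).compl fun x hx => ?_
    have hx0 : x ≠ 0 := hx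
    have hxC : (x : ℂ) ≠ 0 := by exact_mod_cast hx0
    rw [ENNReal.toReal_ofReal (by positivity), ← sq_mul_kolmogorovKernel, Complex.real_smul]
    push_cast
    field_simp

theorem IsLevyKhintchinePair.of_kolmogorov {Ω : Type*} [MeasurableSpace Ω] {P : Measure Ω}
    {Y : Ω → ℝ} (Q : Measure ℝ) [IsFiniteMeasure Q]
    (h : ∀ l : ℝ, ∫ ω, Complex.exp (Complex.I * (l : ℂ) * (Y ω : ℂ)) ∂P =
      Complex.exp (∫ x, kolmogorovKernel l x ∂Q)) :
    IsLevyKhintchinePair P Y (Q.real {0}) (levyMeasure Q) where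
  nonneg := measureReal_nonneg
  no_atom_zero := levyMeasure_singleton_zero Q
  lintegral_min_lt_top :=
    (lintegral_mono fun x => ENNReal.ofReal_le_ofReal (min_le_left _ _)).trans_lt
      ((lintegral_sq_levyMeasure_le Q).trans_lt (measure_lt_top _ _))
  lintegral_sq_lt_top := (setLIntegral_le_lintegral _ _).trans_lt
    ((lintegral_sq_levyMeasure_le Q).trans_lt (measure_lt_top _ _))
  charFun_eq l := by rw [h, integral_levyMeasure]

variable {Ω : Type*} [MeasurableSpace Ω] {P : Measure Ω} {H : Type*}
  [NormedAddCommGroup H] [InnerProductSpace ℝ H] {X : H → Ω → ℝ}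

/-- The measure `E[X(f)²; X(f) ∈ dx]`. -/
def secondMomentMeasure (P : Measure Ω) (X : H → Ω → ℝ) (f : H) : Measure ℝ :=
  (P.withDensity fun ω => ENNReal.ofReal (X f ω ^ 2)).map (X f)

theorem secondMomentMeasure_univ (hX : IsIsometricProcess P X) (f : H) :
    secondMomentMeasure P X f Set.univ = ENNReal.ofReal (‖f‖ ^ 2) := by
  rw [secondMomentMeasure, Measure.map_apply (hX.measurable f) MeasurableSet.univ,
    Set.preimage_univ, withDensity_apply _ MeasurableSet.univ, Measure.restrict_univ,
    ← ofReal_integral_eq_lintegral_ofReal (hX.memLp f).integrable_sq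
      (ae_of_all _ fun _ => sq_nonneg _), hX.integral_sq]

theorem isFiniteMeasure_secondMomentMeasure (hX : IsIsometricProcess P X) (f : H) :
    IsFiniteMeasure (secondMomentMeasure P X f) :=
  ⟨by simp [secondMomentMeasure_univ hX]⟩

variable [IsProbabilityMeasure P]

theorem integral_exp_sub_one_sub (hX : IsIsometricProcess P X) (l : ℝ) (f : H) :
    ∫ ω, (Complex.exp (Complex.I * (l : ℂ) * (X f ω : ℂ)) - 1 - Complex.I * (l : ℂ) * (X f ω : ℂ))
      ∂P = processCharFun P X l f - 1 := by
  have h1 := integrable_exp_I_mul (hX.memLp f).1 l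
  have h2 : Integrable (fun ω => ((X f ω : ℝ) : ℂ)) P :=
    ((hX.memLp f).integrable (by norm_num)).ofReal
  have h3 : Integrable (fun ω => Complex.exp (Complex.I * (l : ℂ) * (X f ω : ℂ)) - 1) P :=
    h1.sub (integrable_const _)
  rw [integral_sub h3 (h2.const_mul _), integral_sub h1 (integrable_const _),
    integral_const_mul, integral_complex_ofReal, hX.centered]
  simp [processCharFun]

theorem norm_processCharFun_sub_one_le (hX : IsIsometricProcess P X) (l : ℝ) (f : H) :
    ‖processCharFun P X l f - 1‖ ≤ 2 * l ^ 2 * ‖f‖ ^ 2 := by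
  rw [← integral_exp_sub_one_sub hX, ← hX.integral_sq, ← integral_const_mul]
  exact norm_integral_le_of_norm_le ((hX.memLp f).integrable_sq.const_mul _)
    (ae_of_all _ fun ω => norm_exp_sub_one_sub_le_sq l _)

/-- The weight `x²` cancels the denominator of the kernel, and the linear term has zero mean because
`X(f)` is centered. -/
theorem integral_kolmogorovKernel_secondMomentMeasure (hX : IsIsometricProcess P X) (l : ℝ)
    (f : H) : ∫ x, kolmogorovKernel l x ∂(secondMomentMeasure P X f) =
      processCharFun P X l f - 1 := by
  have hm := hX.measurable f
  rw [secondMomentMeasure, integral_map hm.aemeasurable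
    (continuous_kolmogorovKernel l).aestronglyMeasurable,
    integral_withDensity_eq_integral_toReal_smul (by fun_prop)
      (ae_of_all _ fun x => ENNReal.ofReal_lt_top), ← integral_exp_sub_one_sub hX]
  refine integral_congr_ae (ae_of_all _ fun ω => ?_)
  simp only
  rw [ENNReal.toReal_ofReal (sq_nonneg _), ← sq_mul_kolmogorovKernel, Complex.real_smul]
  push_cast
  rfl

variable [CompleteSpace H]

/-- Split `h` into increments `D n k` of norm at most `1/(n+1)`. Independence makes `χ_l(h)` the
product of the `χ_l(D n k)`, which differs from `exp ∫ K dG_n` by a quantity tending to 0. A vague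
cluster point of the measures `G_n`, all of mass `‖h‖²`, gives Kolmogorov's measure. -/
theorem exists_isLevyKhintchinePair (hX : IsIsometricProcess P X) {π : ResolutionOfIdentity H}
    (hπ : π ∈ independentResolutions P X) (h : H) :
    ∃ p : ℝ × Measure ℝ, IsLevyKhintchinePair P (X h) p.1 p.2 := by
  choose τ hτ N h0 hN hle using fun n : ℕ =>
    π.exists_subdivision_norm_increment_le h (ε := 1 / ((n : ℝ) + 1)) (by positivity)
  let D : ℕ → ℕ → H := fun n k => π.increment (τ n k) (τ n (k + 1)) h
  have hfin := isFiniteMeasure_secondMomentMeasure hX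
  let G : ℕ → FiniteMeasure ℝ := fun n =>
    ⟨∑ k ∈ Finset.range (N n), secondMomentMeasure P X (D n k), inferInstance⟩
  have hsum : ∀ n, ∑ k ∈ Finset.range (N n), ‖D n k‖ ^ 2 = ‖h‖ ^ 2 := fun n =>
    π.sum_sq_norm_increment (hτ n) (h0 n) (hN n) h
  have hmass : ∀ n, (G n).mass ≤ (‖h‖ ^ 2).toNNReal := by
    intro n
    rw [← ENNReal.coe_le_coe, FiniteMeasure.ennreal_mass]
    change (∑ k ∈ Finset.range (N n), secondMomentMeasure P X (D n k)) Set.univ ≤ _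
    rw [Measure.finsetSum_apply]
    simp only [secondMomentMeasure_univ hX]
    rw [← ENNReal.ofReal_sum_of_nonneg fun _ _ => sq_nonneg _, hsum]
    rfl
  obtain ⟨Q, 𝓤, hQ, h𝓤, h𝓤le, hlim⟩ := exists_vague_cluster_point G _ hmass
  refine ⟨(Q.real {0}, levyMeasure Q), .of_kolmogorov Q fun l => ?_⟩
  change processCharFun P X l h = _
  have hint : ∀ n, ∫ x, kolmogorovKernel l x ∂(G n : Measure ℝ) =
      ∑ k ∈ Finset.range (N n), (processCharFun P X l (D n k) - 1) := by
    intro n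
    change ∫ x, kolmogorovKernel l x
      ∂(∑ k ∈ Finset.range (N n), secondMomentMeasure P X (D n k)) = _
    rw [integral_finsetSum_measure fun k _ => .of_bound
      (continuous_kolmogorovKernel l).aestronglyMeasurable _
      (ae_of_all _ (norm_kolmogorovKernel_le l))]
    simp only [integral_kolmogorovKernel_secondMomentMeasure hX]
  -- The error is at most `∑ 2 ‖χ_l(D) - 1‖² ≤ 8 l⁴ ∑ ‖D‖⁴`; one factor `‖D‖²` is bounded by the
  -- mesh and the other sums to `‖h‖²`.
  have hest : ∀ n : ℕ, ‖processCharFun P X l h -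
      Complex.exp (∫ x, kolmogorovKernel l x ∂(G n : Measure ℝ))‖ ≤
        8 * l ^ 4 * ‖h‖ ^ 2 * (1 / ((n : ℝ) + 1)) ^ 2 := by
    intro n
    have hprod : processCharFun P X l h =
        ∏ k ∈ Finset.range (N n), processCharFun P X l (D n k) := by
      rw [← processCharFun_sum_increment hX hπ (hτ n) l (fun _ => h),
        π.sum_increment_eq (h0 n) (hN n)]
    rw [hint, hprod, ← hsum n, Finset.mul_sum, Finset.sum_mul]
    refine (norm_prod_sub_exp_sum_le _ fun k => norm_processCharFun_le P X l (D n k)).trans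
      (Finset.sum_le_sum fun k _ => ?_)
    have h1 := norm_processCharFun_sub_one_le hX l (D n k)
    have h2 : ‖D n k‖ ^ 2 ≤ (1 / ((n : ℝ) + 1)) ^ 2 :=
      pow_le_pow_left₀ (norm_nonneg _) (hle n k) 2
    calc 2 * ‖processCharFun P X l (D n k) - 1‖ ^ 2 ≤ 2 * (2 * l ^ 2 * ‖D n k‖ ^ 2) ^ 2 := by
          gcongr
      _ = 8 * l ^ 4 * ‖D n k‖ ^ 2 * ‖D n k‖ ^ 2 := by ring
      _ ≤ _ := by gcongr
  have hzero : Tendsto (fun n : ℕ => 8 * l ^ 4 * ‖h‖ ^ 2 * (1 / ((n : ℝ) + 1)) ^ 2) atTop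
      (𝓝 0) := by
    simpa using (tendsto_one_div_add_atTop_nhds_zero_nat (𝕜 := ℝ)).pow 2 |>.const_mul
      (8 * l ^ 4 * ‖h‖ ^ 2)
  have hlim1 : Tendsto (fun n => Complex.exp (∫ x, kolmogorovKernel l x ∂(G n : Measure ℝ))) 𝓤
      (𝓝 (processCharFun P X l h)) := by
    rw [tendsto_iff_norm_sub_tendsto_zero]
    simp only [norm_sub_rev _ (processCharFun P X l h)]
    exact (squeeze_zero (fun _ => norm_nonneg _) hest hzero).mono_left h𝓤le
  have hlim2 := (Complex.continuous_exp.tendsto _).comp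
    (hlim _ (continuous_kolmogorovKernel l) (tendsto_kolmogorovKernel_cocompact l))
  exact tendsto_nhds_unique hlim1 hlim2

/-- Existence of a pair excludes the default value. Uniqueness plays no role, since any admissible
pair gives the same exponential. -/
theorem exp_levyExponent (hX : IsIsometricProcess P X) {π : ResolutionOfIdentity H}
    (hπ : π ∈ independentResolutions P X) (h : H) (l : ℝ) :
    Complex.exp (levyExponent P X h l) = processCharFun P X l h := by
  have hex := exists_isLevyKhintchinePair hX hπ h
  have hp : levyKhintchinePair P X h = hex.choose := dif_pos hex
  rw [levyExponent, hp]
  exact (hex.choose_spec.charFun_eq l).symm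

end LevyKhintchine

/-! ### From elementary integrands to the limit theorem -/

section Convergence

/-- Every subsequence has a further subsequence converging almost surely, to which dominated
convergence applies. -/
theorem tendsto_integral_norm_sub_of_tendstoInMeasure {Ω : Type*} [MeasurableSpace Ω]
    {P : Measure Ω} [IsFiniteMeasure P] {f : ℕ → Ω → ℂ} {φ : ℂ}
    (hf : ∀ n, AEStronglyMeasurable (f n) P) {C : ℝ} (hC : ∀ n ω, ‖f n ω‖ ≤ C)
    (h : TendstoInMeasure P f atTop fun _ => φ) :
    Tendsto (fun n => ∫ ω, ‖f n ω - φ‖ ∂P) atTop (𝓝 0) := by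
  refine tendsto_of_subseq_tendsto fun ns hns => ?_
  obtain ⟨ms, hms, hae⟩ := (h.comp hns).exists_seq_tendsto_ae
  refine ⟨ms, ?_⟩
  have hlim := tendsto_integral_of_dominated_convergence (μ := P) (f := fun _ => (0 : ℝ))
    (F := fun k ω => ‖f (ns (ms k)) ω - φ‖) (fun _ => C + ‖φ‖)
    (fun k => ((hf _).sub aestronglyMeasurable_const).norm) (integrable_const _)
    (fun k => ae_of_all _ fun ω => by
      rw [norm_norm]
      exact (norm_sub_le _ _).trans (add_le_add_left (hC _ _) _)) (by
      filter_upwards [hae] with ω hω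
      exact tendsto_iff_norm_sub_tendsto_zero.1 hω)
  simpa using hlim

variable {Ω : Type*} [MeasurableSpace Ω] {P : Measure Ω} [IsProbabilityMeasure P] {H : Type*}
  [NormedAddCommGroup H] [InnerProductSpace ℝ H] {X : H → Ω → ℝ}

theorem integrable_norm_processCharFun_sub (hX : IsIsometricProcess P X) (l : ℝ) (φ : ℂ)
    {v : Ω → H} (hv : AEStronglyMeasurable v P) :
    Integrable (fun ω => ‖processCharFun P X l (v ω) - φ‖) P := by
  have h := (hX.continuous_processCharFun l).comp_aestronglyMeasurable hv
  exact ((Integrable.of_bound h 1 (ae_of_all _ fun ω => norm_processCharFun_le P X l _)).sub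
    (integrable_const φ)).norm

variable [CompleteSpace H] {π : ResolutionOfIdentity H}

/-- The quantitative principle of conditioning for generalized adapted integrals. -/
theorem IsItoIntegral.norm_charFun_sub_le (hX : IsIsometricProcess P X)
    (hπ : π ∈ independentResolutions P X) {u : Ω → H} (hu : MemLp u 2 P) {J : Ω → ℝ}
    (hJ : IsItoIntegral P X π u J) (l : ℝ) {φ : ℂ} (hφ : φ ≠ 0) (hφ1 : ‖φ‖ ≤ 1) :
    ‖∫ ω, Complex.exp (Complex.I * (l : ℂ) * (J ω : ℂ)) ∂P - φ‖ ≤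
      6 / ‖φ‖ * ∫ ω, ‖processCharFun P X l (u ω) - φ‖ ∂P := by
  obtain ⟨hJ2, e, he, heJ⟩ := hJ
  have hl : Tendsto (fun k => ∫ ω, Complex.exp (Complex.I * (l : ℂ) * ((e k).integral ω : ℂ)) ∂P)
      atTop (𝓝 (∫ ω, Complex.exp (Complex.I * (l : ℂ) * (J ω : ℂ)) ∂P)) := by
    rw [tendsto_iff_norm_sub_tendsto_zero]
    refine squeeze_zero (fun _ => norm_nonneg _)
      (fun k => norm_integral_exp_I_mul_sub_le ((e k).memLp_integral hX hπ) hJ2 l) ?_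
    simpa using ((ENNReal.tendsto_toReal ENNReal.zero_ne_top).comp heJ).const_mul |l|
  have hr : Tendsto (fun k => |l| * (eLpNorm (fun ω => (e k).toFun ω - u ω) 2 P).toReal +
      ∫ ω, ‖processCharFun P X l (u ω) - φ‖ ∂P) atTop
      (𝓝 (∫ ω, ‖processCharFun P X l (u ω) - φ‖ ∂P)) := by
    simpa using (((ENNReal.tendsto_toReal ENNReal.zero_ne_top).comp he).const_mul |l|).add_const
      (∫ ω, ‖processCharFun P X l (u ω) - φ‖ ∂P)
  -- The elementary bound holds for each `e k`; the Lipschitz property of `processCharFun` costs an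
  -- error `|l| ‖e k - u‖` in `L²` norm, which vanishes in the limit.
  refine le_of_tendsto_of_tendsto' (hl.sub_const φ).norm (hr.const_mul (6 / ‖φ‖)) fun k => ?_
  refine ((e k).norm_charFun_integral_sub_le hX hπ l hφ hφ1).trans ?_
  gcongr
  have hd : MemLp (fun ω => (e k).toFun ω - u ω) 2 P := (e k).memLp_toFun.sub hu
  have hdn : MemLp (fun ω => ‖(e k).toFun ω - u ω‖) 2 P := hd.norm
  calc ∫ ω, ‖processCharFun P X l ((e k).toFun ω) - φ‖ ∂P
      ≤ ∫ ω, (|l| * ‖(e k).toFun ω - u ω‖ + ‖processCharFun P X l (u ω) - φ‖) ∂P := by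
        refine integral_mono (integrable_norm_processCharFun_sub hX l φ (e k).memLp_toFun.1)
          (((hdn.integrable (by norm_num)).const_mul _).add
            (integrable_norm_processCharFun_sub hX l φ hu.1)) fun ω => ?_
        refine (norm_sub_le_norm_sub_add_norm_sub _ (processCharFun P X l (u ω)) _).trans ?_
        gcongr
        exact hX.norm_processCharFun_sub_le l _ _
    _ = |l| * ∫ ω, ‖(e k).toFun ω - u ω‖ ∂P + ∫ ω, ‖processCharFun P X l (u ω) - φ‖ ∂P := by
        rw [integral_add ((hdn.integrable (by norm_num)).const_mul _)
          (integrable_norm_processCharFun_sub hX l φ hu.1), integral_const_mul]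
    _ ≤ _ := by
        gcongr
        have h1 := integral_abs_le_toReal_eLpNorm_two hdn
        simpa only [abs_norm, eLpNorm_norm] using h1

theorem isItoIntegral_itoIntegral [TopologicalSpace.SeparableSpace H]
    (hX : IsIsometricProcess P X) (hπ : π ∈ independentResolutions P X) {u : Ω → H}
    (hu : IsAdaptedL2 P X π u) : IsItoIntegral P X π u (itoIntegral P X π u) := by
  have hex := hu.exists_isItoIntegral hX hπ
  rw [itoIntegral, dif_pos hex]
  exact hex.choose_spec

end Convergence

end

theorem corollary8 {Ω : Type*} [MeasurableSpace Ω] (P : Measure Ω) [IsProbabilityMeasure P]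
    {H : Type*} [NormedAddCommGroup H] [InnerProductSpace ℝ H] [CompleteSpace H]
    [TopologicalSpace.SeparableSpace H]
    (X : H → Ω → ℝ) (hX : IsIsometricProcess P X)
    (π : ℕ → ResolutionOfIdentity H) (hπ : ∀ n, π n ∈ independentResolutions P X)
    (u : ℕ → Ω → H) (hu : ∀ n, IsAdaptedL2 P X (π n) (u n))
    (μ : ProbabilityMeasure ℝ) (φ : ℝ → ℂ)
    (hφμ : ∀ l : ℝ, φ l = ∫ x, Complex.exp (Complex.I * (l : ℂ) * (x : ℂ)) ∂(μ : Measure ℝ))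
    (hφ : ∀ l : ℝ, φ l ≠ 0)
    (hconv : ∀ l : ℝ, TendstoInMeasure P
      (fun n ω => Complex.exp (levyExponent P X (u n ω) l)) atTop (fun _ => φ l)) :
    (∀ l : ℝ, Tendsto
      (fun n => ∫ ω, Complex.exp
        (Complex.I * (l : ℂ) * (itoIntegral P X (π n) (u n) ω : ℂ)) ∂P) atTop (𝓝 (φ l))) ∧
    Tendsto (fun n => itoLaw P X (π n) (u n)) atTop (𝓝 μ) := by
  have hφ1 : ∀ l, ‖φ l‖ ≤ 1 := fun l => by
    rw [hφμ]
    refine (norm_integral_le_integral_norm _).trans ?_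
    simp [norm_exp_I_mul_ofReal_mul]
  have hchar : ∀ l : ℝ, Tendsto (fun n => ∫ ω, Complex.exp
      (Complex.I * (l : ℂ) * (itoIntegral P X (π n) (u n) ω : ℂ)) ∂P) atTop (𝓝 (φ l)) := by
    intro l
    -- The exponent does not depend on a resolution, so a single one suffices for all `n`.
    have hexp : ∀ n ω, Complex.exp (levyExponent P X (u n ω) l) =
        processCharFun P X l (u n ω) := fun n ω => exp_levyExponent hX (hπ 0) _ l
    have hc := hconv l
    simp only [hexp] at hc
    have hlim := (tendsto_integral_norm_sub_of_tendstoInMeasure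
      (fun n => (hX.continuous_processCharFun l).comp_aestronglyMeasurable (hu n).memLp.1)
      (fun n ω => norm_processCharFun_le P X l (u n ω)) hc).const_mul (6 / ‖φ l‖)
    rw [mul_zero] at hlim
    rw [tendsto_iff_norm_sub_tendsto_zero]
    exact squeeze_zero (fun _ => norm_nonneg _) (fun n =>
      (isItoIntegral_itoIntegral hX (hπ n) (hu n)).norm_charFun_sub_le hX (hπ n) (hu n).memLp l
        (hφ l) (hφ1 l)) hlim
  refine ⟨hchar, ProbabilityMeasure.tendsto_iff_tendsto_charFun.2 fun l => ?_⟩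
  have hμ : charFun (μ : Measure ℝ) l = φ l := by
    rw [hφμ, charFun_apply_real]
    refine integral_congr_ae (ae_of_all _ fun x => ?_)
    simp only
    congr 1
    ring
  rw [hμ]
  refine (hchar l).congr fun n => ?_
  change _ = charFun (P.map (itoIntegral P X (π n) (u n))) l
  rw [charFun_apply_real, integral_map (aemeasurable_itoIntegral P X (π n) (u n)) (by fun_prop)]
  refine integral_congr_ae (ae_of_all _ fun ω => ?_)
  simp only
  congr 1
  ring
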